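/- Let $p\ge 2$ be an integer, let $X=(\mathbb Z/p)^{\mathbb Z}\times(\mathbb Z/2)^3$ with normalized Haar measure $\mu$, and let $\Gamma=\mathbb Z\times GL_3(\mathbb Z/2)$ act on $X$ via $\rho$: the generator $t$ of $\mathbb Z$ acts by the shift $(\rho(t)a)_j=a_{j+1}$, and $GL_3(\mathbb Z/2)$ acts naturally on $(\mathbb Z/2)^3$. Name the elements of $(\mathbb Z/2)^3$ bijectively $A,B,C,D,F,I,U_1,U_2$ so that the first six are non-zero, and for $x,y\in\{A,B,C,D,F,I\}$ fix any $[xy]\in GL_3(\mathbb Z/2)$ sending $x$ to $y$. For a word $\varepsilon$ in the digits $0,1$ with one digit underlined let $\chi(\varepsilon,x)$ be the characteristic function of the set, also denoted $(\varepsilon,x)$, of all $(m,y)\in X$ with $y=x$ such that the entries of $m$ are zero (non-zero) where $\varepsilon$ has a $0$ (a $1$), the underlined digit being at position $0$. Let $$\begin{aligned}S={}&(-t[ID]+t^{-1}[IA])\chi(1\underline01,I)+(-t^2[AC]-2t^{-1})\chi(1\underline101,A)-t^2[AC]\chi(0\underline101,A)\\&-2t^{-1}\chi(1\underline100,A)+0\cdot\chi(0\underline100,A)-2t^{-1}\chi(1\underline11,A)-[AB]\chi(0\underline11,A)\\&-t\chi(\underline11,B)-[BA]\chi(\underline10,B)+(-t+[CD])\chi(\underline11,C)+[CD]\chi(\underline10,C)\\&-t\chi(\underline11,D)-[DF]\chi(\underline10,D)+0\cdot\chi(\underline10,F)+0\cdot\chi(U),\end{aligned}$$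 where $U$ is the complement of the union of the other sets. Write $S=\sum_i\theta_i\chi_{X_i}$ for this decomposition. An $S$-graph is a non-empty connected directed graph with vertices labeled by the indices $i$ (equivalently by the sets $X_i$) and edges labeled by elements of $\Gamma$, such that for each vertex $v$ the labels of the edges starting at $v$ are pairwise different and form exactly the set $\operatorname{supp}\theta_{L(v)}$. A maximal $X$-embedded $S$-graph is a pair $(\mathbf g,\phi)$ of an $S$-graph $\mathbf g$ and an injection $\phi:V(\mathbf g)\to X$ such that $\phi(v)\in X_{L(v)}$ for every vertex $v$; every edge $e$ from $v$ to $w$ satisfies $\phi(w)=\rho(L(e))\phi(v)$; and whenever $x\in X_i$, $\gamma\in\operatorname{supp}\theta_i$ and $\rho(\gamma)x\in\phi(V(\mathbf g))$, then $x\in\phi(V(\mathbf g))$. Let $S\text{-Graphs}_{\rm fin}$ be the set of isomorphism classes (isomorphisms preserve all labels) of $S$-graphs with finitely many vertices that admit a maximal embedding into $X$, with the discrete measure $\mu$ for which $\mu(\mathbf g)=\mu\{x\in X:\ x\in\phi(V(\mathbf g))$ for some maximal $X$-embedded $S$-graph $(\mathbf g,\phi)\}$. For $k,l\ge1$ consider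 the following graphs. * $\mathbf u$: one vertex, labeled $U$, no edges. * $\mathbf g(k)$: vertices $a_1,\dots,a_k,b_1,\dots,b_k$; edges $a_i\to a_{i+1}$ labeled $t^{-1}$ and $b_{i+1}\to b_i$ labeled $t$ ($1\le i<k$), $b_1\to a_1$ labeled $[BA]$, and, if $k\ge2$, $a_k\to b_k$ labeled $[AB]$. The vertex $b_1$ has label $(\underline10,B)$, the other $b_i$ have label $(\underline11,B)$. If $k=1$, then $a_1$ has label $(0\underline100,A)$. If $k\ge2$, then $a_1$ has label $(1\underline100,A)$, $a_k$ has label $(0\underline11,A)$, and $a_i$ has label $(1\underline11,A)$ for $1<i<k$. * $\mathbf h(l)$: vertices $c_1,\dots,c_l,d_1,\dots,d_l,f$; edges $c_i\to c_{i+1}$ and $d_i\to d_{i+1}$ labeled $t$ ($1\le i<l$), $c_i\to d_i$ labeled $[CD]$ ($1\le i\le l$), $d_l\to f$ labeled $[DF]$. The labels of $c_l,d_l,f$ are $(\underline10,C)$, $(\underline10,D)$, $(\underline10,F)$; for $i<l$ the labels of $c_i,d_i$ are $(\underline11,C)$, $(\underline11,D)$. * $\mathbf j(k,l)$: the disjoint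 union of $\mathbf g(k)$, in which the label of $a_1$ is changed to $(1\underline101,A)$ if $k\ge 2$ and to $(0\underline101,A)$ if $k=1$, of $\mathbf h(l)$, and of a vertex $\iota$ labeled $(1\underline01,I)$, with the additional edges $\iota\to d_1$ labeled $t[ID]$, $\iota\to a_1$ labeled $t^{-1}[IA]$ and $a_1\to c_1$ labeled $t^2[AC]$. Then (the classes of) $\mathbf u$, $\mathbf g(k)$, $\mathbf h(l)$, $\mathbf j(k,l)$ belong to $S\text{-Graphs}_{\rm fin}$, the measure space $(S\text{-Graphs}_{\rm fin},\mu)$ is a probability space, and its points of non-zero measure are exactly $\mathbf u$, $\mathbf g(k)$, $\mathbf h(l)$ and $\mathbf j(k,l)$, $k,l\ge1$. Their measures are $$\mu(\mathbf u)=\tfrac18\Big(2+5\tfrac1p+p^{-3}+2\tfrac{p-1}p p^{-2}+\tfrac{p-1}p+\big(\tfrac{p-1}p\big)^2\Big),$$ $$\mu(\mathbf g(k))=2k\cdot\tfrac18\,p^{-3}\big(\tfrac{p-1}p\big)^k,\qquad \mu(\mathbf h(l))=(2l+1)\cdot\tfrac18\,p^{-3}\big(\tfrac{p-1}p\big)^l,$$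 $$\mu(\mathbf j(k,l))=(2k+2l+2)\cdot\tfrac18\,p^{-3}\big(\tfrac{p-1}p\big)^{k+l}.$$ -/

import Mathlib

open MeasureTheory Matrix

noncomputable section

namespace Lamplighter

/-! ### Operators `S = ∑ θᵢ χᵢ` and `S`-graphs -/

/-- An element `S = ∑ i, θ i * χ i` of `L^∞(X) ⋊ Γ` given in the form used to define `S`-graphs:
an action `ρ` of `Γ` on `X`, elements `θ i` of the group ring `ℂ Γ`, and a measurable partition
of `X` into the sets `cell i` (whose characteristic functions are the `χ i`). -/
structure Operator (Γ X ι : Type) [Group Γ] [MeasurableSpace X] where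
  ρ : Γ →* Equiv.Perm X
  θ : ι → MonoidAlgebra ℂ Γ
  cell : ι → Set X
  measurable_cell : ∀ i, MeasurableSet (cell i)
  disjoint_cell : ∀ i j x, x ∈ cell i → x ∈ cell j → i = j
  cover_cell : ∀ x, ∃ i, x ∈ cell i

/-- A directed graph (loops and multiple edges allowed) with vertices labeled by `ι` and edges
labeled by `Γ`. -/
structure LGraph (Γ ι : Type) where
  V : Type
  E : Type
  src : E → V
  tgt : E → V
  vlab : V → ι
  edgeLab : E → Γ

variable {Γ X ι : Type}

/-- An isomorphism of labeled directed graphs. -/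
structure LGraph.Iso (g h : LGraph Γ ι) where
  onV : g.V ≃ h.V
  onE : g.E ≃ h.E
  src_eq : ∀ e, h.src (onE e) = onV (g.src e)
  tgt_eq : ∀ e, h.tgt (onE e) = onV (g.tgt e)
  vlab_eq : ∀ v, h.vlab (onV v) = g.vlab v
  edgeLab_eq : ∀ e, h.edgeLab (onE e) = g.edgeLab e

instance LGraph.setoid (Γ ι : Type) : Setoid (LGraph Γ ι) where
  r g h := Nonempty (LGraph.Iso g h)
  iseqv :=
    { refl := fun g => ⟨⟨Equiv.refl _, Equiv.refl _, fun _ => rfl, fun _ => rfl, fun _ => rfl,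
        fun _ => rfl⟩⟩
      symm := by
        rintro g h ⟨f⟩
        refine ⟨⟨f.onV.symm, f.onE.symm, fun e => ?_, fun e => ?_, fun v => ?_, fun e => ?_⟩⟩
        · rw [Equiv.eq_symm_apply, ← f.src_eq, Equiv.apply_symm_apply]
        · rw [Equiv.eq_symm_apply, ← f.tgt_eq, Equiv.apply_symm_apply]
        · rw [← f.vlab_eq, Equiv.apply_symm_apply]
        · rw [← f.edgeLab_eq, Equiv.apply_symm_apply]
      trans := by
        rintro g h k ⟨f⟩ ⟨f'⟩
        refine ⟨⟨f.onV.trans f'.onV, f.onE.trans f'.onE, fun e => ?_, fun e => ?_, fun v => ?_,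
          fun e => ?_⟩⟩
        · simp [f.src_eq, f'.src_eq]
        · simp [f.tgt_eq, f'.tgt_eq]
        · simp [f.vlab_eq, f'.vlab_eq]
        · simp [f.edgeLab_eq, f'.edgeLab_eq] }

/-- Isomorphism classes of labeled directed graphs. -/
abbrev LGraphClass (Γ ι : Type) : Type 1 := Quotient (LGraph.setoid Γ ι)

/-- The isomorphism class of a labeled directed graph. -/
def LGraph.cls (g : LGraph Γ ι) : LGraphClass Γ ι := ⟦g⟧

/-- Non-empty, and any two vertices are joined by an undirected path. -/
def LGraph.Connected (g : LGraph Γ ι) : Prop :=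
  Nonempty g.V ∧
    ∀ v w, Relation.EqvGen (fun a b => ∃ e, g.src e = a ∧ g.tgt e = b) v w

variable [Group Γ] [MeasurableSpace X]

/-- `g` is a (connected) `S`-graph: the edges starting at a vertex `v` have pairwise different
labels, and the set of these labels is the support of `θ_{L(v)}`. -/
structure IsSGraph (S : Operator Γ X ι) (g : LGraph Γ ι) : Prop where
  connected : g.Connected
  label_inj : ∀ e e', g.src e = g.src e' → g.edgeLab e = g.edgeLab e' → e = e'
  label_supp : ∀ v γ, (∃ e, g.src e = v ∧ g.edgeLab e = γ) ↔ γ ∈ (S.θ (g.vlab v)).coeff.support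

/-- `(g, φ)` is a maximal `X`-embedded `S`-graph. -/
structure IsMaximalEmbedded (S : Operator Γ X ι) (g : LGraph Γ ι) (φ : g.V → X) : Prop where
  isSGraph : IsSGraph S g
  inj : Function.Injective φ
  mem_cell : ∀ v, φ v ∈ S.cell (g.vlab v)
  edge : ∀ e, φ (g.tgt e) = S.ρ (g.edgeLab e) (φ (g.src e))
  maximal : ∀ i, ∀ x ∈ S.cell i, ∀ γ ∈ (S.θ i).coeff.support, S.ρ γ x ∈ Set.range φ → x ∈ Set.range φ

/-- The set of isomorphism classes of those finite `S`-graphs that admit a maximal embedding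
into `X`. -/
def SGraphsFin (S : Operator Γ X ι) : Type 1 :=
  {c : LGraphClass Γ ι // ∃ g : LGraph Γ ι, g.cls = c ∧ Finite g.V ∧ ∃ φ, IsMaximalEmbedded S g φ}

/-- The weight of an element of `SGraphsFin S`: the measure of the set of the points of `X` that
are vertices of a maximal `X`-embedded `S`-graph of the given isomorphism class. -/
def SGraphsFin.weight (S : Operator Γ X ι) (μ : Measure X) (c : SGraphsFin S) : ENNReal :=
  μ {x | ∃ g : LGraph Γ ι, g.cls = c.1 ∧ ∃ φ, IsMaximalEmbedded S g φ ∧ x ∈ Set.range φ}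

instance (S : Operator Γ X ι) : MeasurableSpace (SGraphsFin S) := ⊤

/-- The discrete measure on `SGraphsFin S` whose point masses are the weights. -/
def SGraphsFin.measure (S : Operator Γ X ι) (μ : Measure X) : Measure (SGraphsFin S) :=
  Measure.sum fun c => SGraphsFin.weight S μ c • Measure.dirac c

/-! ### The space, the group, and the action -/

/-- The compact abelian group `(ℤ/p)^ℤ × (ℤ/2)^3`. -/
abbrev Space (p : ℕ) : Type := (ℤ → ZMod p) × (Fin 3 → ZMod 2)

/-- The normalized Haar measure. -/
def haar (p : ℕ) [NeZero p] : Measure (Space p) := Measure.addHaarMeasure ⊤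

/-- The group `ℤ × GL₃(ℤ/2)`, with `ℤ` written multiplicatively. -/
abbrev Gam : Type := Multiplicative ℤ × GL (Fin 3) (ZMod 2)

/-- The generator of `ℤ`, as an element of `ℤ × GL₃(ℤ/2)`. -/
def t : Gam := (Multiplicative.ofAdd 1, 1)

/-- An element of `GL₃(ℤ/2)`, as an element of `ℤ × GL₃(ℤ/2)`. -/
def lift (M : GL (Fin 3) (ZMod 2)) : Gam := (1, M)

/-- The action: `t` shifts, `(t a)_j = a_{j+1}`, and `GL₃(ℤ/2)` acts naturally on `(ℤ/2)^3`. -/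
def action (p : ℕ) : Gam →* Equiv.Perm (Space p) where
  toFun γ :=
    { toFun := fun x => (fun j => x.1 (j + γ.1.toAdd), γ.2.1 *ᵥ x.2)
      invFun := fun x => (fun j => x.1 (j - γ.1.toAdd), (γ.2⁻¹).1 *ᵥ x.2)
      left_inv := fun x => by
        ext j
        · simp
        · simp only [Matrix.mulVec_mulVec, ← Units.val_mul]; simp
      right_inv := fun x => by
        ext j
        · simp
        · simp only [Matrix.mulVec_mulVec, ← Units.val_mul]; simp }
  map_one' := by ext <;> simp
  map_mul' γ γ' := by
    ext x j
    · simp [add_assoc]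
    · simp [Matrix.mulVec_mulVec]

/-! ### The operator -/

/-- Names for the elements of `(ℤ/2)^3`. -/
inductive Letter
  | A | B | C | D | F | I | U₁ | U₂

/-- Names for the summands of `S`; a digit `0` (`1`) in the name stands for a zero (nonzero)
entry of the sequence, `o` marks the digit that follows it as the one at position `0`. -/
inductive Row
  /-- `(1 0̲ 1, I)` -/
  | I1o01
  /-- `(1 1̲ 0 1, A)` -/
  | A1o101
  /-- `(0 1̲ 0 1, A)` -/
  | A0o101
  /-- `(1 1̲ 0 0, A)` -/
  | A1o100
  /-- `(0 1̲ 0 0, A)` -/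
  | A0o100
  /-- `(1 1̲ 1, A)` -/
  | A1o11
  /-- `(0 1̲ 1, A)` -/
  | A0o11
  /-- `(1̲ 1, B)` -/
  | Bo11
  /-- `(1̲ 0, B)` -/
  | Bo10
  /-- `(1̲ 1, C)` -/
  | Co11
  /-- `(1̲ 0, C)` -/
  | Co10
  /-- `(1̲ 1, D)` -/
  | Do11
  /-- `(1̲ 0, D)` -/
  | Do10
  /-- `(1̲ 0, F)` -/
  | Fo10
  /-- all the rest -/
  | U

section
variable (p : ℕ) (nm : Letter ≃ (Fin 3 → ZMod 2))

/-- The set of the points of `X` for which a row of the table other than the last applies. -/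
def mainCell : Row → Set (Space p)
  | .I1o01 => {x | x.1 (-1) ≠ 0 ∧ x.1 0 = 0 ∧ x.1 1 ≠ 0 ∧ x.2 = nm .I}
  | .A1o101 => {x | x.1 (-1) ≠ 0 ∧ x.1 0 ≠ 0 ∧ x.1 1 = 0 ∧ x.1 2 ≠ 0 ∧ x.2 = nm .A}
  | .A0o101 => {x | x.1 (-1) = 0 ∧ x.1 0 ≠ 0 ∧ x.1 1 = 0 ∧ x.1 2 ≠ 0 ∧ x.2 = nm .A}
  | .A1o100 => {x | x.1 (-1) ≠ 0 ∧ x.1 0 ≠ 0 ∧ x.1 1 = 0 ∧ x.1 2 = 0 ∧ x.2 = nm .A}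
  | .A0o100 => {x | x.1 (-1) = 0 ∧ x.1 0 ≠ 0 ∧ x.1 1 = 0 ∧ x.1 2 = 0 ∧ x.2 = nm .A}
  | .A1o11 => {x | x.1 (-1) ≠ 0 ∧ x.1 0 ≠ 0 ∧ x.1 1 ≠ 0 ∧ x.2 = nm .A}
  | .A0o11 => {x | x.1 (-1) = 0 ∧ x.1 0 ≠ 0 ∧ x.1 1 ≠ 0 ∧ x.2 = nm .A}
  | .Bo11 => {x | x.1 0 ≠ 0 ∧ x.1 1 ≠ 0 ∧ x.2 = nm .B}
  | .Bo10 => {x | x.1 0 ≠ 0 ∧ x.1 1 = 0 ∧ x.2 = nm .B}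
  | .Co11 => {x | x.1 0 ≠ 0 ∧ x.1 1 ≠ 0 ∧ x.2 = nm .C}
  | .Co10 => {x | x.1 0 ≠ 0 ∧ x.1 1 = 0 ∧ x.2 = nm .C}
  | .Do11 => {x | x.1 0 ≠ 0 ∧ x.1 1 ≠ 0 ∧ x.2 = nm .D}
  | .Do10 => {x | x.1 0 ≠ 0 ∧ x.1 1 = 0 ∧ x.2 = nm .D}
  | .Fo10 => {x | x.1 0 ≠ 0 ∧ x.1 1 = 0 ∧ x.2 = nm .F}
  | .U => ∅

/-- The partition of `X` defining `S`; the last set is the complement of the others. -/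
def rowCell : Row → Set (Space p)
  | .U => {x | ∀ r, x ∉ mainCell p nm r}
  | r => mainCell p nm r

theorem mainCell_disjoint (i j : Row) (x : Space p) (hi : x ∈ mainCell p nm i)
    (hj : x ∈ mainCell p nm j) : i = j := by
  cases i <;> cases j <;> first | rfl | (exfalso; simp_all [mainCell])

theorem mainCell_measurable [NeZero p] (r : Row) : MeasurableSet (mainCell p nm r) := by
  have h0 : ∀ j : ℤ, MeasurableSet {x : Space p | x.1 j = 0} := fun j =>
    measurableSet_eq_fun (by fun_prop) measurable_const
  have h1 : ∀ j : ℤ, MeasurableSet {x : Space p | x.1 j ≠ 0} := fun j => (h0 j).compl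
  have h2 : ∀ y, MeasurableSet {x : Space p | x.2 = y} := fun y =>
    measurableSet_eq_fun (by fun_prop) measurable_const
  cases r
  case U => exact MeasurableSet.empty
  all_goals
    repeat' first
      | exact h0 _
      | exact h1 _
      | exact h2 _
      | apply MeasurableSet.inter

end

/-- The elements `θ` of the group ring; `br x y` stands for the automorphism `[xy]`. -/
def rowCoeff (br : Letter → Letter → GL (Fin 3) (ZMod 2)) : Row → MonoidAlgebra ℂ Gam
  | .I1o01 => -.single (t * lift (br .I .D)) 1 + .single (t⁻¹ * lift (br .I .A)) 1
  | .A1o101 => -.single (t ^ 2 * lift (br .A .C)) 1 - .single t⁻¹ 2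
  | .A0o101 => -.single (t ^ 2 * lift (br .A .C)) 1
  | .A1o100 => -.single t⁻¹ 2
  | .A0o100 => 0
  | .A1o11 => -.single t⁻¹ 2
  | .A0o11 => -.single (lift (br .A .B)) 1
  | .Bo11 => -.single t 1
  | .Bo10 => -.single (lift (br .B .A)) 1
  | .Co11 => -.single t 1 + .single (lift (br .C .D)) 1
  | .Co10 => .single (lift (br .C .D)) 1
  | .Do11 => -.single t 1
  | .Do10 => -.single (lift (br .D .F)) 1
  | .Fo10 => 0
  | .U => 0

/-- The operator `S`. -/
def opS (p : ℕ) [NeZero p] (nm : Letter ≃ (Fin 3 → ZMod 2))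
    (br : Letter → Letter → GL (Fin 3) (ZMod 2)) : Operator Gam (Space p) Row where
  ρ := action p
  θ := rowCoeff br
  cell := rowCell p nm
  measurable_cell r := by
    cases r
    case U =>
      have : rowCell p nm .U = ⋂ r ∈ Set.univ, (mainCell p nm r)ᶜ := by
        ext x; simp [rowCell]
      rw [this]
      refine MeasurableSet.biInter ?_ fun r _ => (mainCell_measurable p nm r).compl
      refine Set.Countable.mono (s₂ := ({.I1o01, .A1o101, .A0o101, .A1o100, .A0o100, .A1o11,
        .A0o11, .Bo11, .Bo10, .Co11, .Co10, .Do11, .Do10, .Fo10, .U} : Set Row)) ?_ ?_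
      · intro r _; cases r <;> simp
      · exact Set.Finite.countable (by simp)
    all_goals
      simp only [rowCell]
      exact mainCell_measurable p nm _
  disjoint_cell i j x hi hj := by
    by_cases hU : i = .U <;> by_cases hV : j = .U
    · rw [hU, hV]
    · subst hU
      exact absurd (show x ∈ mainCell p nm j by cases j <;> first | exact hj | simp at hV) (hi j)
    · subst hV
      exact absurd (show x ∈ mainCell p nm i by cases i <;> first | exact hi | simp at hU) (hj i)
    · refine mainCell_disjoint p nm i j x ?_ ?_
      · cases i <;> first | exact hi | simp at hU
      · cases j <;> first | exact hj | simp at hV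
  cover_cell x := by
    by_cases h : ∃ r, x ∈ mainCell p nm r
    · obtain ⟨r, hr⟩ := h
      refine ⟨r, ?_⟩
      cases r <;> first | exact hr | exact absurd hr (Set.notMem_empty x)
    · exact ⟨.U, fun r hr => h ⟨r, hr⟩⟩

/-- The set `S-Graphs_fin` of the operator `S`. -/
abbrev Graphs (p : ℕ) [NeZero p] (nm : Letter ≃ (Fin 3 → ZMod 2))
    (br : Letter → Letter → GL (Fin 3) (ZMod 2)) : Type 1 :=
  SGraphsFin (opS p nm br)

/-- The measure on `S-Graphs_fin` induced by the normalized Haar measure. -/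
abbrev graphsMeasure (p : ℕ) [NeZero p] (nm : Letter ≃ (Fin 3 → ZMod 2))
    (br : Letter → Letter → GL (Fin 3) (ZMod 2)) : Measure (Graphs p nm br) :=
  SGraphsFin.measure (opS p nm br) (haar p)

/-! ### The graphs -/

/-- Names for the vertices of the graphs below. -/
inductive Node
  | a (i : ℕ) | b (i : ℕ) | c (i : ℕ) | d (i : ℕ) | f | iota

/-- The graph with the given vertices and vertex labels, and one edge from `v` to `w` with label
`γ` for every `(v, γ, w)` in `edges` (with `v` and `w` among the vertices). -/
def mkGraph (nodes : Set Node) (lab : Node → Row) (edges : Set (Node × Gam × Node)) :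
    LGraph Gam Row where
  V := nodes
  E := {e : nodes × Gam × nodes // ((e.1 : Node), e.2.1, (e.2.2 : Node)) ∈ edges}
  src e := e.1.1
  tgt e := e.1.2.2
  vlab v := lab v
  edgeLab e := e.1.2.1

/-- The graph `u`: a single vertex with label `U`, no edges. -/
def graphU : LGraph Gam Row where
  V := Unit
  E := Empty
  src e := e.elim
  tgt e := e.elim
  vlab _ := .U
  edgeLab e := e.elim

section
variable (br : Letter → Letter → GL (Fin 3) (ZMod 2))

/-- Vertices `a₁, …, a_k, b₁, …, b_k`. -/
def gNodes (k : ℕ) : Set Node :=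
  {v | ∃ i, 1 ≤ i ∧ i ≤ k ∧ (v = .a i ∨ v = .b i)}

/-- Edges `a_i → a_{i+1}`, `b_{i+1} → b_i` (for `1 ≤ i < k`), `b₁ → a₁`, and, if `2 ≤ k`,
`a_k → b_k`. -/
def gEdges (k : ℕ) : Set (Node × Gam × Node) :=
  {e | (∃ i, 1 ≤ i ∧ i < k ∧ (e = (.a i, t⁻¹, .a (i + 1)) ∨ e = (.b (i + 1), t, .b i))) ∨
    e = (.b 1, lift (br .B .A), .a 1) ∨
    (2 ≤ k ∧ e = (.a k, lift (br .A .B), .b k))}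

/-- Vertices `c₁, …, c_l, d₁, …, d_l, f`. -/
def hNodes (l : ℕ) : Set Node :=
  {v | (∃ i, 1 ≤ i ∧ i ≤ l ∧ (v = .c i ∨ v = .d i)) ∨ v = .f}

/-- Edges `c_i → c_{i+1}`, `d_i → d_{i+1}` (for `1 ≤ i < l`), `c_i → d_i` (for `1 ≤ i ≤ l`), and
`d_l → f`. -/
def hEdges (l : ℕ) : Set (Node × Gam × Node) :=
  {e | (∃ i, 1 ≤ i ∧ i < l ∧ (e = (.c i, t, .c (i + 1)) ∨ e = (.d i, t, .d (i + 1)))) ∨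
    (∃ i, 1 ≤ i ∧ i ≤ l ∧ e = (.c i, lift (br .C .D), .d i)) ∨
    e = (.d l, lift (br .D .F), .f)}

/-- Edges `ι → d₁`, `ι → a₁`, `a₁ → c₁`. -/
def jEdges : Set (Node × Gam × Node) :=
  {(.iota, t * lift (br .I .D), .d 1), (.iota, t⁻¹ * lift (br .I .A), .a 1),
    (.a 1, t ^ 2 * lift (br .A .C), .c 1)}

/-- Labels of the vertices; `multi` is the label of `a₁` if `2 ≤ k`, and `single` is its label if
`k = 1`. -/
def nodeLabel (k l : ℕ) (multi single : Row) : Node → Row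
  | .a i => if i = 1 then (if k = 1 then single else multi)
      else if i = k then .A0o11 else .A1o11
  | .b i => if i = 1 then .Bo10 else .Bo11
  | .c i => if i = l then .Co10 else .Co11
  | .d i => if i = l then .Do10 else .Do11
  | .f => .Fo10
  | .iota => .I1o01

/-- The graph `g(k)`. -/
def graphG (k : ℕ) : LGraph Gam Row :=
  mkGraph (gNodes k) (nodeLabel k 0 .A1o100 .A0o100) (gEdges br k)

/-- The graph `h(l)`. -/
def graphH (l : ℕ) : LGraph Gam Row :=
  mkGraph (hNodes l) (nodeLabel 0 l .A1o100 .A0o100) (hEdges br l)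

/-- The graph `j(k, l)`: copies of `g(k)` and `h(l)`, a vertex `ι`, and three more edges. -/
def graphJ (k l : ℕ) : LGraph Gam Row :=
  mkGraph (gNodes k ∪ hNodes l ∪ {.iota}) (nodeLabel k l .A1o101 .A0o101)
    (gEdges br k ∪ hEdges br l ∪ jEdges br)

end

end Lamplighter

end

/-!
An `S`-graph embedded maximally is a weakly connected component of the directed graph on `X` in
which `x`, in the cell `X_i`, has an edge to `ρ(γ) x` for every `γ ∈ supp θ_i`. Hence two maximal
embedded graphs through the same point are isomorphic (`IsMaximalEmbedded.cls_eq`), and it suffices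
to find, for almost every point, a maximal embedded graph through it.

All four families are indexed by pairs `(k, l)` of run lengths: `u` has index `(0, 0)`, `g(k)` has
index `(k, 0)`, `h(l)` has index `(0, l)`. For `(k, l) ≠ (0, 0)` consider the windows
`0 1 … 1 0 1 … 1 0` with two runs of lengths `k` and `l` of nonzero entries, separated by single
zeros. A run of length `0` gives two adjacent zeros, so that windows with `l = 0` or `k = 0` are
exactly the surroundings of `g(k)` and `h(l)`. Sending every vertex to the shift of the sequence by
its position in the window is a maximal embedding (`isMaximalEmbedded_runGraph`): the nontrivial
point is that no edge enters from outside (`exists_embed_eq_of_action_eq_embed`). The points of the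
last cell `U` have no edges at all (`isMaximalEmbedded_graphU`).

A sequence whose zeros are unbounded in both directions decomposes into runs, so every point over it
is a vertex of one of these graphs (`exists_mem_pairSet`), and almost all sequences are of this
kind. The graphs are pairwise non-isomorphic, since `k` and `l` are the numbers of vertices over `B`
and over `C` (`eq_of_cls_pairGraph_eq`). Therefore the weight of the graph with index `(k, l)` is the
measure of the set of its possible vertices, all other weights vanish, and the weights sum to the
total mass of `X`. For `(k, l) ≠ (0, 0)` the set of possible vertices is the disjoint union, over the
vertices, of cylinders fixing `3` zeros, `k + l` nonzero entries and the second component, which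
gives the measures (`haar_pairSet`); the measure of the cell `U` is computed from its complement.
-/

namespace Lamplighter

/-! ### Haar measure of cylinders -/

section Haar
variable (p : ℕ) [NeZero p]

instance isAddHaarMeasure_haar : (haar p).IsAddHaarMeasure := by
  unfold haar; infer_instance

instance isProbabilityMeasure_haar : IsProbabilityMeasure (haar p) :=
  ⟨Measure.addHaarMeasure_self (K₀ := ⊤)⟩

/-- On a finite group an invariant measure is a multiple of the counting measure. -/
theorem measure_finset_eq_card_mul {H : Type*} [AddGroup H] [MeasurableSpace H]
    [MeasurableSingletonClass H] [MeasurableAdd H] (ν : Measure H) [ν.IsAddLeftInvariant]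
    (s : Finset H) : ν s = s.card * ν {0} := by
  have h : ∀ x, ν {x} = ν {0} := fun x => by
    rw [← measure_preimage_add ν x {x}]
    congr 1
    ext y
    simp
  rw [← Set.biUnion_of_singleton (s : Set H)]
  simp only [Finset.mem_coe]
  rw [measure_biUnion_finset]
  · simp [h]
  · intro x _ y _ hxy
    simpa using hxy
  · exact fun x _ => measurableSet_singleton x

/-- The set of the points with second component `y`, zero entries at the positions in `T` and
nonzero entries at the positions in `N`. -/
def cylinder (T N : Finset ℤ) (y : Fin 3 → ZMod 2) : Set (Space p) :=
  {x | (∀ j ∈ T, x.1 j = 0) ∧ (∀ j ∈ N, x.1 j ≠ 0) ∧ x.2 = y}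

theorem measurableSet_cylinder (T N : Finset ℤ) (y : Fin 3 → ZMod 2) :
    MeasurableSet (cylinder p T N y) := by
  have h0 : ∀ j : ℤ, MeasurableSet {x : Space p | x.1 j = 0} := fun j =>
    measurableSet_eq_fun (by fun_prop) measurable_const
  have h : cylinder p T N y = (⋂ j ∈ T, {x : Space p | x.1 j = 0}) ∩
      ((⋂ j ∈ N, {x : Space p | x.1 j = 0}ᶜ) ∩ {x | x.2 = y}) := by
    ext x
    simp [cylinder]
  rw [h]
  exact (T.measurableSet_biInter fun j _ => h0 j).inter
    ((N.measurableSet_biInter fun j _ => (h0 j).compl).inter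
      (measurableSet_eq_fun (by fun_prop) measurable_const))

theorem haar_cylinder (T N : Finset ℤ) (hTN : Disjoint T N) (y : Fin 3 → ZMod 2) :
    haar p (cylinder p T N y) =
      ENNReal.ofReal (1 / 8 * (1 / (p : ℝ)) ^ T.card * (((p : ℝ) - 1) / p) ^ N.card) := by
  classical
  have hp0 : (p : ℝ) ≠ 0 := Nat.cast_ne_zero.2 (NeZero.ne p)
  have hp1 : 1 ≤ p := Nat.one_le_iff_ne_zero.2 (NeZero.ne p)
  -- Restricting the sequence to `T ∪ N` pushes the Haar measure to that of a finite group.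
  let H := ((T ∪ N : Finset ℤ) → ZMod p) × (Fin 3 → ZMod 2)
  let f : Space p →+ H :=
    { toFun := fun x => (fun j => x.1 j, x.2)
      map_zero' := rfl
      map_add' := fun _ _ => rfl }
  let ν : Measure H := Measure.addHaarMeasure ⊤
  have hν : ν Set.univ = 1 := Measure.addHaarMeasure_self (K₀ := ⊤)
  have hf : Continuous f := by
    change Continuous fun x : Space p => ((fun j : (T ∪ N : Finset ℤ) => x.1 j, x.2) : H)
    fun_prop
  have hsurj : Function.Surjective f := by
    rintro ⟨z, w⟩
    refine ⟨(fun j => if h : j ∈ T ∪ N then z ⟨j, h⟩ else 0, w), ?_⟩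
    ext j
    · simp [f, -Finset.mem_union]
    · rfl
  have hmp : MeasurePreserving f (haar p) ν :=
    AddMonoidHom.measurePreserving hf hsurj (by rw [hν, measure_univ])
  let s : Finset H :=
    Fintype.piFinset (fun j : (T ∪ N : Finset ℤ) =>
      if (j : ℤ) ∈ T then ({0} : Finset (ZMod p)) else {0}ᶜ) ×ˢ {y}
  have hset : cylinder p T N y = f ⁻¹' (s : Set H) := by
    ext x
    constructor
    · rintro ⟨h1, h2, h3⟩
      refine Finset.mem_coe.2 (Finset.mem_product.2
        ⟨Fintype.mem_piFinset.2 fun j => ?_, Finset.mem_singleton.2 h3⟩)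
      split_ifs with hT
      · exact Finset.mem_singleton.2 (h1 j hT)
      · exact Finset.mem_compl.2 fun h0 =>
          h2 j ((Finset.mem_union.1 j.2).resolve_left hT) (Finset.mem_singleton.1 h0)
    · intro hx
      obtain ⟨h, h3⟩ := Finset.mem_product.1 (Finset.mem_coe.1 hx)
      have h := Fintype.mem_piFinset.1 h
      refine ⟨fun j hj => ?_, fun j hj => ?_, Finset.mem_singleton.1 h3⟩
      · have := h ⟨j, Finset.mem_union_left _ hj⟩
        rw [if_pos hj] at this
        exact Finset.mem_singleton.1 this
      · have := h ⟨j, Finset.mem_union_right _ hj⟩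
        rw [if_neg (Finset.disjoint_right.1 hTN hj)] at this
        exact fun h0 => Finset.mem_compl.1 this (Finset.mem_singleton.2 h0)
  have hcard : s.card = (p - 1) ^ N.card := by
    rw [Finset.card_product, Fintype.card_piFinset, Finset.card_singleton, mul_one,
      Finset.prod_coe_sort (T ∪ N)
        (fun j => (if j ∈ T then ({0} : Finset (ZMod p)) else {0}ᶜ).card),
      Finset.prod_union hTN, Finset.prod_congr rfl (g := fun _ => 1),
      Finset.prod_congr (s₁ := N) rfl (g := fun _ => p - 1)]
    · simp
    · intro j hj
      simp [Finset.disjoint_right.1 hTN hj, Finset.card_compl, ZMod.card]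
    · intro j hj
      simp [hj]
  have h0 : ν {0} = ENNReal.ofReal ((p : ℝ) ^ (T.card + N.card) * 8)⁻¹ := by
    have h := measure_finset_eq_card_mul ν Finset.univ
    have hH : (Finset.univ : Finset H).card = p ^ (T.card + N.card) * 8 := by
      rw [← Finset.card_union_of_disjoint hTN]
      simp [H, ZMod.card]
    rw [Finset.coe_univ, hν, hH] at h
    rw [ENNReal.ofReal_inv_of_pos (by positivity)]
    refine ENNReal.eq_inv_of_mul_eq_one_left ?_
    rw [h, mul_comm]
    congr 1
    rw [← ENNReal.ofReal_natCast]
    push_cast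
    rfl
  rw [hset, hmp.measure_preimage s.measurableSet.nullMeasurableSet,
    measure_finset_eq_card_mul, h0, hcard, ← ENNReal.ofReal_natCast,
    ← ENNReal.ofReal_mul (by positivity)]
  congr 1
  push_cast [Nat.cast_sub hp1]
  rw [div_pow, div_pow, one_pow, pow_add]
  field_simp

/-- Almost surely, a sequence does not avoid zero along any given sequence of positions. -/
theorem ae_exists_eq_zero (e : ℕ → ℤ) (he : Function.Injective e) :
    ∀ᵐ x ∂haar p, ∃ i, x.1 (e i) = 0 := by
  have hp : (0 : ℝ) < p := Nat.cast_pos.2 (NeZero.pos p)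
  have hp1 : (1 : ℝ) ≤ p := Nat.one_le_cast.2 (NeZero.one_le)
  suffices h : ∀ y, haar p {x | (∀ i, x.1 (e i) ≠ 0) ∧ x.2 = y} = 0 by
    rw [ae_iff]
    refine measure_mono_null (fun x hx => Set.mem_iUnion.2 ⟨x.2, ?_⟩) (measure_iUnion_null h)
    exact ⟨fun i hi => hx ⟨i, hi⟩, rfl⟩
  intro y
  have hle : ∀ n : ℕ, haar p {x | (∀ i, x.1 (e i) ≠ 0) ∧ x.2 = y} ≤
      ENNReal.ofReal (1 / 8 * (((p : ℝ) - 1) / p) ^ n) := fun n => by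
    have h := haar_cylinder p ∅ ((Finset.range n).map ⟨e, he⟩) (Finset.disjoint_empty_left _) y
    simp only [Finset.card_empty, pow_zero, mul_one, Finset.card_map, Finset.card_range] at h
    rw [← h]
    refine measure_mono fun x hx => ⟨by simp, fun j hj => ?_, hx.2⟩
    obtain ⟨i, -, rfl⟩ := Finset.mem_map.1 hj
    exact hx.1 i
  have hlim : Filter.Tendsto (fun n : ℕ => ENNReal.ofReal (1 / 8 * (((p : ℝ) - 1) / p) ^ n))
      Filter.atTop (nhds 0) := by
    rw [← ENNReal.ofReal_zero, ← mul_zero (1 / 8 : ℝ)]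
    refine ENNReal.tendsto_ofReal ((tendsto_pow_atTop_nhds_zero_of_lt_one ?_ ?_).const_mul _)
    · exact div_nonneg (by linarith) hp.le
    · rw [div_lt_one hp]
      linarith
  exact le_antisymm (ge_of_tendsto' hlim hle) zero_le

end Haar

/-! ### Uniqueness of the graph through a point -/

section Unique
variable {Γ X ι : Type} [Group Γ] [MeasurableSpace X] {S : Operator Γ X ι}

/-- The vertex set of a maximal embedded graph is closed under following and reversing the
edges of `S`, so it contains the vertex set of any embedded graph that it meets. -/
theorem IsMaximalEmbedded.range_subset {g h : LGraph Γ ι} {φ : g.V → X} {ψ : h.V → X}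
    (hφ : IsMaximalEmbedded S g φ) (hψ : IsMaximalEmbedded S h ψ) {x : X}
    (hx : x ∈ Set.range φ) (hx' : x ∈ Set.range ψ) : Set.range ψ ⊆ Set.range φ := by
  have key : ∀ v w, Relation.EqvGen (fun a b => ∃ e, h.src e = a ∧ h.tgt e = b) v w →
      (ψ v ∈ Set.range φ ↔ ψ w ∈ Set.range φ) := by
    intro v w hvw
    induction hvw with
    | rel v w hvw =>
      obtain ⟨e, rfl, rfl⟩ := hvw
      have hsupp : h.edgeLab e ∈ (S.θ (h.vlab (h.src e))).coeff.support :=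
        (hψ.isSGraph.label_supp _ _).1 ⟨e, rfl, rfl⟩
      rw [hψ.edge]
      refine ⟨?_, hφ.maximal _ _ (hψ.mem_cell _) _ hsupp⟩
      rintro ⟨a, ha⟩
      have hl : g.vlab a = h.vlab (h.src e) :=
        S.disjoint_cell _ _ _ (hφ.mem_cell a) (ha ▸ hψ.mem_cell _)
      obtain ⟨e', h1, h2⟩ := (hφ.isSGraph.label_supp a _).2 (hl ▸ hsupp)
      exact ⟨g.tgt e', by rw [hφ.edge, h1, h2, ha]⟩
    | refl v => rfl
    | symm v w _ ih => exact ih.symm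
    | trans u v w _ _ h1 h2 => exact h1.trans h2
  obtain ⟨v, rfl⟩ := hx'
  rintro _ ⟨w, rfl⟩
  exact (key v w (hψ.isSGraph.connected.2 v w)).1 hx

/-- Two maximal embedded graphs through the same point are isomorphic. -/
theorem IsMaximalEmbedded.cls_eq {g h : LGraph Γ ι} {φ : g.V → X} {ψ : h.V → X}
    (hφ : IsMaximalEmbedded S g φ) (hψ : IsMaximalEmbedded S h ψ) {x : X}
    (hx : x ∈ Set.range φ) (hx' : x ∈ Set.range ψ) : g.cls = h.cls := by
  have hr : Set.range φ = Set.range ψ :=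
    Set.Subset.antisymm (hψ.range_subset hφ hx' hx) (hφ.range_subset hψ hx hx')
  let eV : g.V ≃ h.V := (Equiv.ofInjective φ hφ.inj).trans
    ((Equiv.setCongr hr).trans (Equiv.ofInjective ψ hψ.inj).symm)
  have hV : ∀ v, ψ (eV v) = φ v := fun v => by
    have := Equiv.apply_ofInjective_symm hψ.inj
      (Equiv.setCongr hr (Equiv.ofInjective φ hφ.inj v))
    simpa [eV] using this
  have hl : ∀ v, h.vlab (eV v) = g.vlab v := fun v =>
    S.disjoint_cell _ _ _ (hψ.mem_cell _) (hV v ▸ hφ.mem_cell v)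
  have ex : ∀ e : g.E, ∃ e' : h.E, h.src e' = eV (g.src e) ∧ h.edgeLab e' = g.edgeLab e :=
    fun e => (hψ.isSGraph.label_supp _ _).2
      (hl _ ▸ (hφ.isSGraph.label_supp _ _).1 ⟨e, rfl, rfl⟩)
  choose fE hfs hfl using ex
  have hbij : Function.Bijective fE := by
    constructor
    · intro e e' hee
      refine hφ.isSGraph.label_inj e e' (eV.injective ?_) ?_
      · rw [← hfs, ← hfs, hee]
      · rw [← hfl, ← hfl, hee]
    · intro e
      obtain ⟨e', h1, h2⟩ := (hφ.isSGraph.label_supp (eV.symm (h.src e)) (h.edgeLab e)).2 (by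
        rw [← hl, Equiv.apply_symm_apply]
        exact (hψ.isSGraph.label_supp _ _).1 ⟨e, rfl, rfl⟩)
      refine ⟨e', hψ.isSGraph.label_inj _ _ ?_ ?_⟩
      · rw [hfs, h1, Equiv.apply_symm_apply]
      · rw [hfl, h2]
  refine Quotient.sound ⟨⟨eV, Equiv.ofBijective fE hbij, hfs, fun e => hψ.inj ?_, hl, hfl⟩⟩
  change ψ (h.tgt (fE e)) = _
  rw [hψ.edge, hfl, hfs, hV, hV, hφ.edge]

end Unique

/-! ### The family of graphs indexed by pairs of run lengths -/

/-- The support of `rowCoeff br r`. -/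
def rowSupp (br : Letter → Letter → GL (Fin 3) (ZMod 2)) : Row → Set Gam
  | .I1o01 => {t * lift (br .I .D), t⁻¹ * lift (br .I .A)}
  | .A1o101 => {t ^ 2 * lift (br .A .C), t⁻¹}
  | .A0o101 => {t ^ 2 * lift (br .A .C)}
  | .A1o100 => {t⁻¹}
  | .A0o100 => ∅
  | .A1o11 => {t⁻¹}
  | .A0o11 => {lift (br .A .B)}
  | .Bo11 => {t}
  | .Bo10 => {lift (br .B .A)}
  | .Co11 => {t, lift (br .C .D)}
  | .Co10 => {lift (br .C .D)}
  | .Do11 => {t}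
  | .Do10 => {lift (br .D .F)}
  | .Fo10 => ∅
  | .U => ∅

theorem mem_support_rowCoeff (br : Letter → Letter → GL (Fin 3) (ZMod 2)) (r : Row) (γ : Gam) :
    γ ∈ (rowCoeff br r).coeff.support ↔ γ ∈ rowSupp br r := by
  have hneg : ∀ x : MonoidAlgebra ℂ Gam, (-x).coeff = -x.coeff := fun _ => rfl
  have hsub : ∀ x y : MonoidAlgebra ℂ Gam, (x - y).coeff = x.coeff - y.coeff := fun _ _ => rfl
  -- No cancellation occurs: the two terms of a row with two terms differ in their shift.
  have h1 : ∀ M N, t * lift M ≠ t⁻¹ * lift N := fun M N h => by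
    have := congrArg (fun γ : Gam => γ.1.toAdd) h
    simp [t, lift] at this
  have h2 : ∀ M, t ^ 2 * lift M ≠ t⁻¹ := fun M h => by
    have := congrArg (fun γ : Gam => γ.1.toAdd) h
    simp [t, lift] at this
  have h3 : ∀ M, t ≠ lift M := fun M h => by
    have := congrArg (fun γ : Gam => γ.1.toAdd) h
    simp [t, lift] at this
  classical
  cases r <;>
    simp only [rowCoeff, rowSupp, Finsupp.mem_support_iff, MonoidAlgebra.coeff_add, hneg, hsub,
      MonoidAlgebra.coeff_single, MonoidAlgebra.coeff_zero, Finsupp.coe_add, Finsupp.coe_neg,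
      Finsupp.coe_sub, Finsupp.coe_zero, Pi.add_apply, Pi.neg_apply, Pi.sub_apply, Pi.zero_apply,
      Finsupp.single_apply, Set.mem_insert_iff, Set.mem_singleton_iff, Set.mem_empty_iff_false,
      eq_comm (b := γ)] <;>
    (try split_ifs) <;>
    first
      | exact (h1 _ _ (‹γ = t * _›.symm.trans ‹γ = t⁻¹ * _›)).elim
      | exact (h2 _ (‹γ = t ^ 2 * _›.symm.trans ‹γ = t⁻¹›)).elim
      | exact (h3 _ (‹γ = t›.symm.trans ‹γ = lift _›)).elim
      | simp_all

/-- The vertices of the graph of a run of length `k` and a run of length `l` separated by a single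
zero; a run of length `0` contributes no vertices. -/
def runNodes (k l : ℕ) : Set Node :=
  {v | match v with
    | .a i => 1 ≤ i ∧ i ≤ k
    | .b i => 1 ≤ i ∧ i ≤ k
    | .c i => 1 ≤ i ∧ i ≤ l
    | .d i => 1 ≤ i ∧ i ≤ l
    | .f => 1 ≤ l
    | .iota => 1 ≤ k ∧ 1 ≤ l}

section
variable {k l i : ℕ}

@[simp] theorem a_mem_runNodes : .a i ∈ runNodes k l ↔ 1 ≤ i ∧ i ≤ k := Iff.rfl
@[simp] theorem b_mem_runNodes : .b i ∈ runNodes k l ↔ 1 ≤ i ∧ i ≤ k := Iff.rfl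
@[simp] theorem c_mem_runNodes : .c i ∈ runNodes k l ↔ 1 ≤ i ∧ i ≤ l := Iff.rfl
@[simp] theorem d_mem_runNodes : .d i ∈ runNodes k l ↔ 1 ≤ i ∧ i ≤ l := Iff.rfl
@[simp] theorem f_mem_runNodes : .f ∈ runNodes k l ↔ 1 ≤ l := Iff.rfl
@[simp] theorem iota_mem_runNodes : .iota ∈ runNodes k l ↔ 1 ≤ k ∧ 1 ≤ l := Iff.rfl

end

/-- The vertex labels of the graph of the runs of lengths `k` and `l`. -/
def runLabel (k l : ℕ) : Node → Row :=
  nodeLabel k l (if 1 ≤ k ∧ 1 ≤ l then .A1o101 else .A1o100)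
    (if 1 ≤ k ∧ 1 ≤ l then .A0o101 else .A0o100)

section
variable (br : Letter → Letter → GL (Fin 3) (ZMod 2))

/-- The edges of the graph of the runs of lengths `k` and `l`. -/
def runEdges (k l : ℕ) : Set (Node × Gam × Node) :=
  {e | 1 ≤ k ∧ e ∈ gEdges br k ∨ 1 ≤ l ∧ e ∈ hEdges br l ∨ (1 ≤ k ∧ 1 ≤ l) ∧ e ∈ jEdges br}

/-- The graph of the runs of lengths `k` and `l`: it is `g(k)` if `l = 0`, `h(l)` if `k = 0`, and
`j(k, l)` if neither is zero. -/
def runGraph (k l : ℕ) : LGraph Gam Row :=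
  mkGraph (runNodes k l) (runLabel k l) (runEdges br k l)

theorem graphG_eq_runGraph {k : ℕ} (hk : 1 ≤ k) : graphG br k = runGraph br k 0 := by
  have h1 : gNodes k = runNodes k 0 := by
    ext v; cases v <;> simp [gNodes, runNodes] <;> grind
  have h2 : gEdges br k = runEdges br k 0 := by
    ext e; simp [runEdges, hk]
  simp [graphG, runGraph, runLabel, h1, h2]

theorem graphH_eq_runGraph {l : ℕ} (hl : 1 ≤ l) : graphH br l = runGraph br 0 l := by
  have h1 : hNodes l = runNodes 0 l := by
    ext v; cases v <;> simp [hNodes, runNodes] <;> grind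
  have h2 : hEdges br l = runEdges br 0 l := by
    ext e; simp [runEdges, hl]
  simp [graphH, runGraph, runLabel, h1, h2]

theorem graphJ_eq_runGraph {k l : ℕ} (hk : 1 ≤ k) (hl : 1 ≤ l) :
    graphJ br k l = runGraph br k l := by
  have h1 : gNodes k ∪ hNodes l ∪ {.iota} = runNodes k l := by
    ext v; cases v <;> simp [gNodes, hNodes, runNodes] <;> grind
  have h2 : gEdges br k ∪ hEdges br l ∪ jEdges br = runEdges br k l := by
    ext e; simp [runEdges, hk, hl, or_assoc]
  simp [graphJ, runGraph, runLabel, h1, h2, hk, hl]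

section
variable {br} {k l : ℕ} {γ : Gam} {w : Node}

theorem edge_from_a {i : ℕ} : (.a i, γ, w) ∈ runEdges br k l ↔
    (1 ≤ i ∧ i < k ∧ γ = t⁻¹ ∧ w = .a (i + 1)) ∨
    (2 ≤ k ∧ i = k ∧ γ = lift (br .A .B) ∧ w = .b k) ∨
    (1 ≤ k ∧ 1 ≤ l ∧ i = 1 ∧ γ = t ^ 2 * lift (br .A .C) ∧ w = .c 1) := by
  simp [runEdges, gEdges, hEdges, jEdges]; grind

theorem edge_from_b {i : ℕ} : (.b i, γ, w) ∈ runEdges br k l ↔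
    (2 ≤ i ∧ i ≤ k ∧ γ = t ∧ w = .b (i - 1)) ∨
    (1 ≤ k ∧ i = 1 ∧ γ = lift (br .B .A) ∧ w = .a 1) := by
  simp [runEdges, gEdges, hEdges, jEdges]; grind

theorem edge_from_c {i : ℕ} : (.c i, γ, w) ∈ runEdges br k l ↔
    (1 ≤ i ∧ i < l ∧ γ = t ∧ w = .c (i + 1)) ∨
    (1 ≤ i ∧ i ≤ l ∧ γ = lift (br .C .D) ∧ w = .d i) := by
  simp [runEdges, gEdges, hEdges, jEdges]; grind

theorem edge_from_d {i : ℕ} : (.d i, γ, w) ∈ runEdges br k l ↔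
    (1 ≤ i ∧ i < l ∧ γ = t ∧ w = .d (i + 1)) ∨
    (1 ≤ l ∧ i = l ∧ γ = lift (br .D .F) ∧ w = .f) := by
  simp [runEdges, gEdges, hEdges, jEdges]; grind

theorem not_edge_from_f : (.f, γ, w) ∉ runEdges br k l := by
  simp [runEdges, gEdges, hEdges, jEdges]

theorem edge_from_iota : (.iota, γ, w) ∈ runEdges br k l ↔
    (1 ≤ k ∧ 1 ≤ l ∧ γ = t * lift (br .I .D) ∧ w = .d 1) ∨
    (1 ≤ k ∧ 1 ≤ l ∧ γ = t⁻¹ * lift (br .I .A) ∧ w = .a 1) := by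
  simp [runEdges, gEdges, hEdges, jEdges]; grind

end

/-- The labels of the edges starting at a vertex are those that the operator prescribes. -/
theorem exists_edge_iff {k l : ℕ} {v : Node} (hv : v ∈ runNodes k l) (γ : Gam) :
    (∃ w ∈ runNodes k l, (v, γ, w) ∈ runEdges br k l) ↔ γ ∈ rowSupp br (runLabel k l v) := by
  cases v with
  | a i =>
    obtain ⟨h1, h2⟩ := hv
    simp only [edge_from_a, runLabel, nodeLabel]
    split_ifs <;> simp [rowSupp, and_or_left, exists_or] <;> grind
  | b i =>
    obtain ⟨h1, h2⟩ := hv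
    simp only [edge_from_b, runLabel, nodeLabel]
    split_ifs <;> simp [rowSupp, and_or_left, exists_or] <;> grind
  | c i =>
    obtain ⟨h1, h2⟩ := hv
    simp only [edge_from_c, runLabel, nodeLabel]
    split_ifs <;> simp [rowSupp, and_or_left, exists_or] <;> grind
  | d i =>
    obtain ⟨h1, h2⟩ := hv
    simp only [edge_from_d, runLabel, nodeLabel]
    split_ifs <;> simp [rowSupp, and_or_left, exists_or] <;> grind
  | f => simp [not_edge_from_f, runLabel, nodeLabel, rowSupp]
  | iota =>
    obtain ⟨h1, h2⟩ := hv
    simp only [edge_from_iota, runLabel, nodeLabel]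
    simp [rowSupp, and_or_left, exists_or]
    grind

theorem connected_runGraph {k l : ℕ} (hkl : 1 ≤ k ∨ 1 ≤ l) : (runGraph br k l).Connected := by
  let R : runNodes k l → runNodes k l → Prop := Relation.EqvGen
    fun a b => ∃ e, (runGraph br k l).src e = a ∧ (runGraph br k l).tgt e = b
  have hR : ∀ (v w : runNodes k l) (γ : Gam), ((v : Node), γ, (w : Node)) ∈ runEdges br k l →
      R v w := fun v w γ h => .rel _ _ ⟨⟨(v, γ, w), h⟩, rfl, rfl⟩
  have ha : ∀ i (h1 : 1 ≤ i) (h2 : i ≤ k),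
      R ⟨.a i, h1, h2⟩ ⟨.a 1, le_rfl, h1.trans h2⟩ := by
    intro i h1
    induction i, h1 using Nat.le_induction with
    | base => exact fun _ => .refl _
    | succ i h1 ih =>
      refine fun h2 => .trans _ _ _ (.symm _ _ ?_) (ih (by omega))
      exact hR _ _ t⁻¹ (edge_from_a.2 (by grind))
  have hb : ∀ i (h1 : 1 ≤ i) (h2 : i ≤ k),
      R ⟨.b i, h1, h2⟩ ⟨.a 1, le_rfl, h1.trans h2⟩ := by
    intro i h1
    induction i, h1 using Nat.le_induction with
    | base => exact fun h2 => hR _ _ (lift (br .B .A)) (edge_from_b.2 (by grind))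
    | succ i h1 ih =>
      refine fun h2 => .trans _ _ _ ?_ (ih (by omega))
      exact hR _ _ t (edge_from_b.2 (by grind))
  have hc : ∀ i (h1 : 1 ≤ i) (h2 : i ≤ l),
      R ⟨.c i, h1, h2⟩ ⟨.c 1, le_rfl, h1.trans h2⟩ := by
    intro i h1
    induction i, h1 using Nat.le_induction with
    | base => exact fun _ => .refl _
    | succ i h1 ih =>
      refine fun h2 => .trans _ _ _ (.symm _ _ ?_) (ih (by omega))
      exact hR _ _ t (edge_from_c.2 (by grind))
  have hd : ∀ i (h1 : 1 ≤ i) (h2 : i ≤ l),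
      R ⟨.d i, h1, h2⟩ ⟨.c 1, le_rfl, h1.trans h2⟩ := fun i h1 h2 =>
    .trans _ _ _ (.symm _ _ (hR ⟨.c i, h1, h2⟩ _ (lift (br .C .D)) (edge_from_c.2 (by grind))))
      (hc i h1 h2)
  have hf : ∀ h : 1 ≤ l, R ⟨.f, h⟩ ⟨.c 1, le_rfl, h⟩ := fun h =>
    .trans _ _ _ (.symm _ _ (hR ⟨.d l, h, le_rfl⟩ _ (lift (br .D .F)) (edge_from_d.2 (by grind))))
      (hd l h le_rfl)
  have hac : ∀ (h1 : 1 ≤ k) (h2 : 1 ≤ l), R ⟨.a 1, le_rfl, h1⟩ ⟨.c 1, le_rfl, h2⟩ :=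
    fun h1 h2 => hR _ _ (t ^ 2 * lift (br .A .C)) (edge_from_a.2 (by grind))
  have hi : ∀ (h1 : 1 ≤ k) (h2 : 1 ≤ l), R ⟨.iota, h1, h2⟩ ⟨.a 1, le_rfl, h1⟩ :=
    fun h1 h2 => hR _ _ (t⁻¹ * lift (br .I .A)) (edge_from_iota.2 (by grind))
  -- It suffices to connect every vertex to one that is chosen once and for all.
  suffices h : ∃ o : runNodes k l, ∀ v, R v o by
    obtain ⟨o, ho⟩ := h
    exact ⟨⟨o⟩, fun v w => .trans _ _ _ (ho v) (.symm _ _ (ho w))⟩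
  by_cases hk : 1 ≤ k
  · refine ⟨⟨.a 1, le_rfl, hk⟩, ?_⟩
    rintro ⟨v, hv⟩
    cases v with
    | a i => exact ha i hv.1 hv.2
    | b i => exact hb i hv.1 hv.2
    | c i => exact .trans _ _ _ (hc i hv.1 hv.2) (.symm _ _ (hac hk (hv.1.trans hv.2)))
    | d i => exact .trans _ _ _ (hd i hv.1 hv.2) (.symm _ _ (hac hk (hv.1.trans hv.2)))
    | f => exact .trans _ _ _ (hf hv) (.symm _ _ (hac hk hv))
    | iota => exact hi hv.1 hv.2
  · refine ⟨⟨.c 1, le_rfl, hkl.resolve_left hk⟩, ?_⟩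
    rintro ⟨v, hv⟩
    cases v with
    | a i => exact absurd (hv.1.trans hv.2) hk
    | b i => exact absurd (hv.1.trans hv.2) hk
    | c i => exact hc i hv.1 hv.2
    | d i => exact hd i hv.1 hv.2
    | f => exact hf hv
    | iota => exact absurd hv.1 hk

end

/-! ### Embeddings of the graphs -/

/-- The second component of the points of `X` to which a vertex is sent. -/
def Node.letter : Node → Letter
  | .a _ => .A
  | .b _ => .B
  | .c _ => .C
  | .d _ => .D
  | .f => .F
  | .iota => .I

/-- The position of a vertex. The run of length `k` occupies the positions `1, …, k`, and the run
of length `l` the positions `k + 2, …, k + l + 1`; the vertices `a_i`, `b_i` are numbered from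
right to left. -/
def Node.pos (k l : ℕ) : Node → ℤ
  | .a i => k + 1 - i
  | .b i => k + 1 - i
  | .c i => k + 1 + i
  | .d i => k + 1 + i
  | .f => k + 1 + l
  | .iota => k + 1

/-- The sequence `m` reads `0 1 … 1 0 1 … 1 0` from position `0` on, with runs of `k` and `l`
nonzero entries. -/
def IsWindow {p : ℕ} (k l : ℕ) (m : ℤ → ZMod p) : Prop :=
  ∀ j : ℤ, 0 ≤ j → j ≤ k + l + 2 → (m j = 0 ↔ j = 0 ∨ j = k + 1 ∨ j = k + l + 2)

/-- The point to which a vertex is sent by the embedding defined by the sequence `m`. -/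
def embed {p : ℕ} (nm : Letter ≃ (Fin 3 → ZMod 2)) (k l : ℕ) (m : ℤ → ZMod p) (v : Node) :
    Space p :=
  (fun j => m (j + v.pos k l), nm v.letter)

section
variable {p : ℕ} {nm : Letter ≃ (Fin 3 → ZMod 2)} {k l : ℕ} {m m' : ℤ → ZMod p}

theorem pos_mem_window {v : Node} (hv : v ∈ runNodes k l) :
    1 ≤ v.pos k l ∧ v.pos k l ≤ k + l + 1 := by
  cases v <;> simp [Node.pos] at hv ⊢ <;> omega

theorem embed_mem_rowCell (hm : IsWindow k l m) {v : Node} (hv : v ∈ runNodes k l) :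
    embed nm k l m v ∈ rowCell p nm (runLabel k l v) := by
  have hz : ∀ j : ℤ, 0 ≤ j → j ≤ k + l + 2 → (j = 0 ∨ j = k + 1 ∨ j = k + l + 2) → m j = 0 :=
    fun j h1 h2 => (hm j h1 h2).2
  have hn : ∀ j : ℤ, 0 ≤ j → j ≤ k + l + 2 → ¬(j = 0 ∨ j = k + 1 ∨ j = k + l + 2) → m j ≠ 0 :=
    fun j h1 h2 => mt (hm j h1 h2).1
  cases v <;> simp only [a_mem_runNodes, b_mem_runNodes, c_mem_runNodes, d_mem_runNodes,
      f_mem_runNodes, iota_mem_runNodes] at hv <;> simp only [runLabel, nodeLabel] <;>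
    (try split_ifs) <;>
    simp only [rowCell, mainCell, embed, Node.pos, Node.letter, Set.mem_ofPred_eq] <;>
    and_intros <;>
    first
      | trivial
      | exact hz _ (by omega) (by omega) (by omega)
      | exact hn _ (by omega) (by omega) (by omega)

/-- The windows of two shifts of a sequence by less than the length of a run exclude each other. -/
theorem IsWindow.not_shift (hm : IsWindow k l m) (hm' : IsWindow k l m') {s : ℤ}
    (h : ∀ j, m j = m' (j + s)) (hs : 1 ≤ s) : ¬(s < k ∨ s < l) := by
  rintro (hk | hl)
  · have h0 := (hm 0 (by omega) (by omega)).2 (by omega)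
    rw [h] at h0
    have := (hm' _ (by omega) (by omega)).1 h0
    omega
  · have h0 := (hm (k + 1) (by omega) (by omega)).2 (by omega)
    rw [h] at h0
    have := (hm' _ (by omega) (by omega)).1 h0
    omega

/-- The sets of points to which different vertices can be sent are disjoint. -/
theorem embed_injective (hm : IsWindow k l m) (hm' : IsWindow k l m') {v w : Node}
    (hv : v ∈ runNodes k l) (hw : w ∈ runNodes k l)
    (h : embed nm k l m v = embed nm k l m' w) : v = w := by
  have hl : v.letter = w.letter := nm.injective (congrArg Prod.snd h)
  have hq : ∀ j, m j = m' (j + (w.pos k l - v.pos k l)) := fun j => by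
    have := congrFun (congrArg Prod.fst h) (j - v.pos k l)
    simp only [embed, sub_add_cancel] at this
    rw [this]
    congr 1
    ring
  have hq' : ∀ j, m' j = m (j + (v.pos k l - w.pos k l)) := fun j => by
    rw [hq]
    congr 1
    ring
  have h1 := hm.not_shift hm' hq
  have h2 := hm'.not_shift hm hq'
  cases v <;> cases w <;> simp [Node.letter, Node.pos] at hl hv hw h1 h2 ⊢ <;> omega

variable {br : Letter → Letter → GL (Fin 3) (ZMod 2)}

theorem embed_edge
    (hbr : ∀ x y, x ≠ .U₁ → x ≠ .U₂ → y ≠ .U₁ → y ≠ .U₂ →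
      (br x y : Matrix (Fin 3) (Fin 3) (ZMod 2)).mulVec (nm x) = nm y)
    {v w : Node} {γ : Gam} (h : (v, γ, w) ∈ runEdges br k l) :
    embed nm k l m w = action p γ (embed nm k l m v) := by
  -- The positions and the letters are compared separately.
  suffices hs : w.pos k l = v.pos k l + γ.1.toAdd ∧ nm w.letter = γ.2.1 *ᵥ nm v.letter by
    refine Prod.ext (funext fun j => ?_) hs.2
    change m (j + w.pos k l) = m (j + γ.1.toAdd + v.pos k l)
    rw [hs.1]
    congr 1
    ring
  cases v with
  | a i =>
    rcases edge_from_a.1 h with ⟨_, _, rfl, rfl⟩ | ⟨_, rfl, rfl, rfl⟩ | ⟨_, _, rfl, rfl, rfl⟩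
    all_goals
      refine ⟨?_, ?_⟩ <;> simp [Node.pos, Node.letter, t, lift, hbr]
      try ring
  | b i =>
    rcases edge_from_b.1 h with ⟨_, _, rfl, rfl⟩ | ⟨_, rfl, rfl, rfl⟩
    all_goals
      refine ⟨?_, ?_⟩ <;> simp [Node.pos, Node.letter, t, lift, hbr]
      try omega
  | c i =>
    rcases edge_from_c.1 h with ⟨_, _, rfl, rfl⟩ | ⟨_, _, rfl, rfl⟩
    all_goals
      refine ⟨?_, ?_⟩ <;> simp [Node.pos, Node.letter, t, lift, hbr]
      try ring
  | d i =>
    rcases edge_from_d.1 h with ⟨_, _, rfl, rfl⟩ | ⟨_, rfl, rfl, rfl⟩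
    all_goals
      refine ⟨?_, ?_⟩ <;> simp [Node.pos, Node.letter, t, lift, hbr]
      try ring
  | f => exact absurd h not_edge_from_f
  | iota =>
    rcases edge_from_iota.1 h with ⟨_, _, rfl, rfl⟩ | ⟨_, _, rfl, rfl⟩
    all_goals
      refine ⟨?_, ?_⟩ <;> simp [Node.pos, Node.letter, t, lift, hbr]

end

/-! ### Maximality of the embeddings -/

section
variable {k l : ℕ} {w : Node}

theorem exists_eq_a (hw : w ∈ runNodes k l) (h : w.letter = .A) :
    ∃ i, w = .a i ∧ 1 ≤ i ∧ i ≤ k := by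
  cases w <;> simp_all [Node.letter]

theorem exists_eq_b (hw : w ∈ runNodes k l) (h : w.letter = .B) :
    ∃ i, w = .b i ∧ 1 ≤ i ∧ i ≤ k := by
  cases w <;> simp_all [Node.letter]

theorem exists_eq_c (hw : w ∈ runNodes k l) (h : w.letter = .C) :
    ∃ i, w = .c i ∧ 1 ≤ i ∧ i ≤ l := by
  cases w <;> simp_all [Node.letter]

theorem exists_eq_d (hw : w ∈ runNodes k l) (h : w.letter = .D) :
    ∃ i, w = .d i ∧ 1 ≤ i ∧ i ≤ l := by
  cases w <;> simp_all [Node.letter]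

theorem eq_f (hw : w ∈ runNodes k l) (h : w.letter = .F) : w = .f ∧ 1 ≤ l := by
  cases w <;> simp_all [Node.letter]

end

section
variable {p : ℕ} {nm : Letter ≃ (Fin 3 → ZMod 2)} {k l : ℕ} {m : ℤ → ZMod p}
  {br : Letter → Letter → GL (Fin 3) (ZMod 2)}

/-- A point that is moved to the image of the vertex `w` by an element with shift `s` is
determined by its second component. -/
theorem of_action_eq_embed {x : Space p} {γ : Gam} {w : Node} {s : ℤ} {L L' : Letter}
    (h : action p γ x = embed nm k l m w) (hL : x.2 = nm L) (hs : γ.1.toAdd = s)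
    (hM : γ.2.1 *ᵥ nm L = nm L') :
    w.letter = L' ∧ (∀ j, x.1 j = m (j + (w.pos k l - s))) ∧
      ∀ v, v.letter = L → v.pos k l = w.pos k l - s → embed nm k l m v = x := by
  have hx : ∀ j, x.1 j = m (j + (w.pos k l - s)) := fun j => by
    have := congrFun (congrArg Prod.fst h) (j - s)
    simp only [action, embed, MonoidHom.coe_mk, OneHom.coe_mk, Equiv.coe_fn_mk, hs,
      sub_add_cancel] at this
    rw [this]
    congr 1
    ring
  refine ⟨nm.injective ?_, hx, fun v hv hpos => Prod.ext (funext fun j => ?_) ?_⟩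
  · rw [← hM, ← hL]
    exact (congrArg Prod.snd h).symm
  · rw [hx, ← hpos]
    rfl
  · rw [hL, ← hv]
    rfl

/-- The image of the vertices is closed under reversing the edges of the operator: a point with
an edge to the image of a vertex is itself the image of a vertex. In each case, the row of the
table that applies to the point determines where it lies with respect to the window. -/
theorem exists_embed_eq_of_action_eq_embed
    (hbr : ∀ x y, x ≠ .U₁ → x ≠ .U₂ → y ≠ .U₁ → y ≠ .U₂ →
      (br x y : Matrix (Fin 3) (Fin 3) (ZMod 2)).mulVec (nm x) = nm y)
    (hm : IsWindow k l m) {r : Row} {x : Space p} (hx : x ∈ rowCell p nm r) {γ : Gam}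
    (hγ : γ ∈ rowSupp br r) {w : Node} (hw : w ∈ runNodes k l)
    (h : action p γ x = embed nm k l m w) : ∃ v ∈ runNodes k l, embed nm k l m v = x := by
  cases r with
  | I1o01 =>
    obtain ⟨h1, h2, h3, hL⟩ := hx
    obtain rfl | rfl := hγ
    · obtain ⟨hl, hq, hv⟩ := of_action_eq_embed (s := 1) (L' := .D) h hL
        (by simp [t, lift]) (by simp [t, lift, hbr])
      obtain ⟨i, rfl, hi⟩ := exists_eq_d hw hl
      rw [hq] at h1 h2 h3
      simp only [Node.pos] at h1 h2 h3
      have e1 := mt (hm _ (by omega) (by omega)).2 h1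
      have e2 := (hm _ (by omega) (by omega)).1 h2
      have e3 := mt (hm _ (by omega) (by omega)).2 h3
      exact ⟨.iota, by simp; omega, hv .iota rfl (by simp only [Node.pos]; omega)⟩
    · obtain ⟨hl, hq, hv⟩ := of_action_eq_embed (s := -1) (L' := .A) h hL
        (by simp [t, lift]) (by simp [t, lift, hbr])
      obtain ⟨i, rfl, hi⟩ := exists_eq_a hw hl
      rw [hq] at h1 h2 h3
      simp only [Node.pos] at h1 h2 h3
      have e1 := mt (hm _ (by omega) (by omega)).2 h1
      have e2 := (hm _ (by omega) (by omega)).1 h2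
      have e3 := mt (hm _ (by omega) (by omega)).2 h3
      exact ⟨.iota, by simp; omega, hv .iota rfl (by simp only [Node.pos]; omega)⟩
  | A1o101 =>
    obtain ⟨h1, h2, h3, h4, hL⟩ := hx
    obtain rfl | rfl := hγ
    · obtain ⟨hl, hq, hv⟩ := of_action_eq_embed (s := 2) (L' := .C) h hL
        (by simp [t, lift]) (by simp [t, lift, hbr])
      obtain ⟨i, rfl, hi⟩ := exists_eq_c hw hl
      rw [hq] at h2 h3 h4
      simp only [Node.pos] at h2 h3 h4
      have e2 := mt (hm _ (by omega) (by omega)).2 h2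
      have e3 := (hm _ (by omega) (by omega)).1 h3
      have e4 := mt (hm _ (by omega) (by omega)).2 h4
      exact ⟨.a 1, by simp; omega, hv (.a 1) rfl (by simp only [Node.pos]; omega)⟩
    · obtain ⟨hl, hq, hv⟩ := of_action_eq_embed (s := -1) (L' := .A) h hL
        (by simp [t]) (by simp [t])
      obtain ⟨i, rfl, hi⟩ := exists_eq_a hw hl
      rw [hq] at h1 h2 h3 h4
      simp only [Node.pos] at h1 h2 h3 h4
      have e1 := mt (hm _ (by omega) (by omega)).2 h1
      have e2 := mt (hm _ (by omega) (by omega)).2 h2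
      have e3 := (hm _ (by omega) (by omega)).1 h3
      have e4 := mt (hm _ (by omega) (by omega)).2 h4
      exact ⟨.a (i - 1), by simp; omega, hv (.a (i - 1)) rfl (by simp only [Node.pos]; omega)⟩
  | A0o101 =>
    obtain ⟨h1, h2, h3, h4, hL⟩ := hx
    obtain rfl := hγ
    obtain ⟨hl, hq, hv⟩ := of_action_eq_embed (s := 2) (L' := .C) h hL
      (by simp [t, lift]) (by simp [t, lift, hbr])
    obtain ⟨i, rfl, hi⟩ := exists_eq_c hw hl
    rw [hq] at h2 h3 h4
    simp only [Node.pos] at h2 h3 h4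
    have e2 := mt (hm _ (by omega) (by omega)).2 h2
    have e3 := (hm _ (by omega) (by omega)).1 h3
    have e4 := mt (hm _ (by omega) (by omega)).2 h4
    exact ⟨.a 1, by simp; omega, hv (.a 1) rfl (by simp only [Node.pos]; omega)⟩
  | A1o100 =>
    obtain ⟨h1, h2, h3, h4, hL⟩ := hx
    obtain rfl := hγ
    obtain ⟨hl, hq, hv⟩ := of_action_eq_embed (s := -1) (L' := .A) h hL
      (by simp [t]) (by simp [t])
    obtain ⟨i, rfl, hi⟩ := exists_eq_a hw hl
    rw [hq] at h1 h2 h3 h4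
    simp only [Node.pos] at h1 h2 h3 h4
    have e1 := mt (hm _ (by omega) (by omega)).2 h1
    have e2 := mt (hm _ (by omega) (by omega)).2 h2
    have e3 := (hm _ (by omega) (by omega)).1 h3
    have e4 := (hm _ (by omega) (by omega)).1 h4
    exact ⟨.a (i - 1), by simp; omega, hv (.a (i - 1)) rfl (by simp only [Node.pos]; omega)⟩
  | A0o100 => exact absurd hγ (Set.notMem_empty γ)
  | A1o11 =>
    obtain ⟨h1, h2, h3, hL⟩ := hx
    obtain rfl := hγ
    obtain ⟨hl, hq, hv⟩ := of_action_eq_embed (s := -1) (L' := .A) h hL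
      (by simp [t]) (by simp [t])
    obtain ⟨i, rfl, hi⟩ := exists_eq_a hw hl
    rw [hq] at h1 h2 h3
    simp only [Node.pos] at h1 h2 h3
    have e1 := mt (hm _ (by omega) (by omega)).2 h1
    have e2 := mt (hm _ (by omega) (by omega)).2 h2
    have e3 := mt (hm _ (by omega) (by omega)).2 h3
    exact ⟨.a (i - 1), by simp; omega, hv (.a (i - 1)) rfl (by simp only [Node.pos]; omega)⟩
  | A0o11 =>
    obtain ⟨h1, h2, h3, hL⟩ := hx
    obtain rfl := hγ
    obtain ⟨hl, hq, hv⟩ := of_action_eq_embed (s := 0) (L' := .B) h hL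
      (by simp [lift]) (by simp [lift, hbr])
    obtain ⟨i, rfl, hi⟩ := exists_eq_b hw hl
    rw [hq] at h1 h2 h3
    simp only [Node.pos] at h1 h2 h3
    have e1 := (hm _ (by omega) (by omega)).1 h1
    have e2 := mt (hm _ (by omega) (by omega)).2 h2
    have e3 := mt (hm _ (by omega) (by omega)).2 h3
    exact ⟨.a i, by simp; omega, hv (.a i) rfl (by simp only [Node.pos]; omega)⟩
  | Bo11 =>
    obtain ⟨h1, h2, hL⟩ := hx
    obtain rfl := hγ
    obtain ⟨hl, hq, hv⟩ := of_action_eq_embed (s := 1) (L' := .B) h hL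
      (by simp [t]) (by simp [t])
    obtain ⟨i, rfl, hi⟩ := exists_eq_b hw hl
    rw [hq] at h1 h2
    simp only [Node.pos] at h1 h2
    have e1 := mt (hm _ (by omega) (by omega)).2 h1
    have e2 := mt (hm _ (by omega) (by omega)).2 h2
    exact ⟨.b (i + 1), by simp; omega, hv (.b (i + 1)) rfl (by simp only [Node.pos]; omega)⟩
  | Bo10 =>
    obtain ⟨h1, h2, hL⟩ := hx
    obtain rfl := hγ
    obtain ⟨hl, hq, hv⟩ := of_action_eq_embed (s := 0) (L' := .A) h hL
      (by simp [lift]) (by simp [lift, hbr])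
    obtain ⟨i, rfl, hi⟩ := exists_eq_a hw hl
    rw [hq] at h1 h2
    simp only [Node.pos] at h1 h2
    have e1 := mt (hm _ (by omega) (by omega)).2 h1
    have e2 := (hm _ (by omega) (by omega)).1 h2
    exact ⟨.b i, by simp; omega, hv (.b i) rfl (by simp only [Node.pos]; omega)⟩
  | Co11 =>
    obtain ⟨h1, h2, hL⟩ := hx
    obtain rfl | rfl := hγ
    · obtain ⟨hl, hq, hv⟩ := of_action_eq_embed (s := 1) (L' := .C) h hL
        (by simp [t]) (by simp [t])
      obtain ⟨i, rfl, hi⟩ := exists_eq_c hw hl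
      rw [hq] at h1 h2
      simp only [Node.pos] at h1 h2
      have e1 := mt (hm _ (by omega) (by omega)).2 h1
      have e2 := mt (hm _ (by omega) (by omega)).2 h2
      exact ⟨.c (i - 1), by simp; omega, hv (.c (i - 1)) rfl (by simp only [Node.pos]; omega)⟩
    · obtain ⟨hl, hq, hv⟩ := of_action_eq_embed (s := 0) (L' := .D) h hL
        (by simp [lift]) (by simp [lift, hbr])
      obtain ⟨i, rfl, hi⟩ := exists_eq_d hw hl
      rw [hq] at h1 h2
      simp only [Node.pos] at h1 h2
      have e1 := mt (hm _ (by omega) (by omega)).2 h1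
      have e2 := mt (hm _ (by omega) (by omega)).2 h2
      exact ⟨.c i, by simp; omega, hv (.c i) rfl (by simp only [Node.pos]; omega)⟩
  | Co10 =>
    obtain ⟨h1, h2, hL⟩ := hx
    obtain rfl := hγ
    obtain ⟨hl, hq, hv⟩ := of_action_eq_embed (s := 0) (L' := .D) h hL
      (by simp [lift]) (by simp [lift, hbr])
    obtain ⟨i, rfl, hi⟩ := exists_eq_d hw hl
    rw [hq] at h1 h2
    simp only [Node.pos] at h1 h2
    have e1 := mt (hm _ (by omega) (by omega)).2 h1
    have e2 := (hm _ (by omega) (by omega)).1 h2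
    exact ⟨.c i, by simp; omega, hv (.c i) rfl (by simp only [Node.pos]; omega)⟩
  | Do11 =>
    obtain ⟨h1, h2, hL⟩ := hx
    obtain rfl := hγ
    obtain ⟨hl, hq, hv⟩ := of_action_eq_embed (s := 1) (L' := .D) h hL
      (by simp [t]) (by simp [t])
    obtain ⟨i, rfl, hi⟩ := exists_eq_d hw hl
    rw [hq] at h1 h2
    simp only [Node.pos] at h1 h2
    have e1 := mt (hm _ (by omega) (by omega)).2 h1
    have e2 := mt (hm _ (by omega) (by omega)).2 h2
    exact ⟨.d (i - 1), by simp; omega, hv (.d (i - 1)) rfl (by simp only [Node.pos]; omega)⟩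
  | Do10 =>
    obtain ⟨h1, h2, hL⟩ := hx
    obtain rfl := hγ
    obtain ⟨hl, hq, hv⟩ := of_action_eq_embed (s := 0) (L' := .F) h hL
      (by simp [lift]) (by simp [lift, hbr])
    obtain ⟨rfl, hi⟩ := eq_f hw hl
    rw [hq] at h1 h2
    simp only [Node.pos] at h1 h2
    have e1 := mt (hm _ (by omega) (by omega)).2 h1
    have e2 := (hm _ (by omega) (by omega)).1 h2
    exact ⟨.d l, by simp; omega, hv (.d l) rfl (by simp only [Node.pos]; omega)⟩
  | Fo10 => exact absurd hγ (Set.notMem_empty γ)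
  | U => exact absurd hγ (Set.notMem_empty γ)

end

section
variable {p : ℕ} {nm : Letter ≃ (Fin 3 → ZMod 2)} {k l : ℕ} {m : ℤ → ZMod p}
  {br : Letter → Letter → GL (Fin 3) (ZMod 2)}

/-- Every window in a sequence carries a maximal embedding of the graph of its two runs. -/
theorem isMaximalEmbedded_runGraph [NeZero p]
    (hbr : ∀ x y, x ≠ .U₁ → x ≠ .U₂ → y ≠ .U₁ → y ≠ .U₂ →
      (br x y : Matrix (Fin 3) (Fin 3) (ZMod 2)).mulVec (nm x) = nm y)
    (hkl : 1 ≤ k ∨ 1 ≤ l) (hm : IsWindow k l m) :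
    IsMaximalEmbedded (opS p nm br) (runGraph br k l) (fun v => embed nm k l m v.1) := by
  have hinj : Function.Injective fun v : (runGraph br k l).V => embed nm k l m v.1 :=
    fun v w h => Subtype.ext (embed_injective hm hm v.2 w.2 h)
  have hedge : ∀ e : (runGraph br k l).E, embed nm k l m ((runGraph br k l).tgt e).1 =
      action p ((runGraph br k l).edgeLab e) (embed nm k l m ((runGraph br k l).src e).1) :=
    fun e => embed_edge hbr e.2
  refine ⟨⟨connected_runGraph br hkl, fun e e' hs hl => ?_, fun v γ => ?_⟩, hinj,
    fun v => embed_mem_rowCell hm v.2, hedge, ?_⟩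
  · -- The target of an edge is determined by its source and its label, as the embedding is
    -- injective.
    have ht : (runGraph br k l).tgt e = (runGraph br k l).tgt e' := hinj (by
      change embed nm k l m _ = embed nm k l m _
      rw [hedge, hedge, hs, hl])
    exact Subtype.ext (Prod.ext hs (Prod.ext hl ht))
  · change _ ↔ γ ∈ (rowCoeff br _).coeff.support
    rw [mem_support_rowCoeff]
    refine Iff.trans ?_ (exists_edge_iff br v.2 γ)
    constructor
    · rintro ⟨e, rfl, rfl⟩
      exact ⟨_, e.1.2.2.2, e.2⟩
    · rintro ⟨w, hw, h⟩
      exact ⟨⟨(v, γ, ⟨w, hw⟩), h⟩, rfl, rfl⟩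
  · rintro r x hx γ hγ ⟨w, hw⟩
    obtain ⟨v, hv, rfl⟩ := exists_embed_eq_of_action_eq_embed hbr hm hx
      ((mem_support_rowCoeff br r γ).1 hγ) w.2 hw.symm
    exact ⟨⟨v, hv⟩, rfl⟩

/-- A description of the complement of the last cell that groups the rows by letters. -/
theorem notMem_rowCell_U {x : Space p} : x ∉ rowCell p nm .U ↔
    (x.1 0 ≠ 0 ∧ x.2 = nm .A) ∨ (x.1 0 ≠ 0 ∧ x.2 = nm .B) ∨ (x.1 0 ≠ 0 ∧ x.2 = nm .C) ∨
    (x.1 0 ≠ 0 ∧ x.2 = nm .D) ∨ (x.1 0 ≠ 0 ∧ x.1 1 = 0 ∧ x.2 = nm .F) ∨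
    (x.1 (-1) ≠ 0 ∧ x.1 0 = 0 ∧ x.1 1 ≠ 0 ∧ x.2 = nm .I) := by
  have h : x ∉ rowCell p nm .U ↔ ∃ r, x ∈ mainCell p nm r := by
    simp [rowCell]
  rw [h]
  constructor
  · rintro ⟨r, hr⟩
    cases r <;> simp only [mainCell, Set.mem_ofPred_eq, Set.mem_empty_iff_false] at hr <;> tauto
  · rintro (⟨h0, hL⟩ | ⟨h0, hL⟩ | ⟨h0, hL⟩ | ⟨h0, hL⟩ | h | h)
    · by_cases h1 : x.1 1 = 0 <;> by_cases h2 : x.1 (-1) = 0 <;> by_cases h3 : x.1 2 = 0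
      · exact ⟨.A0o100, h2, h0, h1, h3, hL⟩
      · exact ⟨.A0o101, h2, h0, h1, h3, hL⟩
      · exact ⟨.A1o100, h2, h0, h1, h3, hL⟩
      · exact ⟨.A1o101, h2, h0, h1, h3, hL⟩
      · exact ⟨.A0o11, h2, h0, h1, hL⟩
      · exact ⟨.A0o11, h2, h0, h1, hL⟩
      · exact ⟨.A1o11, h2, h0, h1, hL⟩
      · exact ⟨.A1o11, h2, h0, h1, hL⟩
    · by_cases h1 : x.1 1 = 0
      · exact ⟨.Bo10, h0, h1, hL⟩
      · exact ⟨.Bo11, h0, h1, hL⟩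
    · by_cases h1 : x.1 1 = 0
      · exact ⟨.Co10, h0, h1, hL⟩
      · exact ⟨.Co11, h0, h1, hL⟩
    · by_cases h1 : x.1 1 = 0
      · exact ⟨.Do10, h0, h1, hL⟩
      · exact ⟨.Do11, h0, h1, hL⟩
    · exact ⟨.Fo10, h⟩
    · exact ⟨.I1o01, h⟩

/-- No edge of the operator leads into its last cell. -/
theorem action_notMem_rowCell_U
    (hbr : ∀ x y, x ≠ .U₁ → x ≠ .U₂ → y ≠ .U₁ → y ≠ .U₂ →
      (br x y : Matrix (Fin 3) (Fin 3) (ZMod 2)).mulVec (nm x) = nm y)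
    {r : Row} {x : Space p} (hx : x ∈ rowCell p nm r) {γ : Gam} (hγ : γ ∈ rowSupp br r) :
    action p γ x ∉ rowCell p nm .U := by
  rw [notMem_rowCell_U]
  cases r <;>
    simp only [rowSupp, Set.mem_insert_iff, Set.mem_singleton_iff,
      Set.mem_empty_iff_false] at hγ <;>
    simp only [rowCell, mainCell, Set.mem_ofPred_eq] at hx <;>
    rcases hγ with rfl | rfl <;>
    simp [action, t, lift, hx, hbr]

theorem isMaximalEmbedded_graphU [NeZero p]
    (hbr : ∀ x y, x ≠ .U₁ → x ≠ .U₂ → y ≠ .U₁ → y ≠ .U₂ →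
      (br x y : Matrix (Fin 3) (Fin 3) (ZMod 2)).mulVec (nm x) = nm y)
    {x : Space p} (hx : x ∈ rowCell p nm .U) :
    IsMaximalEmbedded (opS p nm br) graphU (fun _ => x) := by
  refine ⟨⟨⟨⟨()⟩, fun v w => .refl _⟩, fun e => e.elim, fun v γ => ?_⟩,
    fun _ _ _ => rfl, fun _ => hx, fun e => e.elim, ?_⟩
  · change _ ↔ γ ∈ (rowCoeff br .U).coeff.support
    rw [mem_support_rowCoeff]
    exact ⟨fun ⟨e, _⟩ => e.elim, fun h => absurd h (Set.notMem_empty γ)⟩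
  · rintro r y hy γ hγ ⟨_, h⟩
    refine absurd ?_ (action_notMem_rowCell_U hbr hy ((mem_support_rowCoeff br r γ).1 hγ))
    change x = action p γ y at h
    exact h ▸ hx

end

/-! ### Distinguishing the graphs -/

section

/-- The graph with index `(k, l)`, including `u` for `k = l = 0`. -/
def pairGraph (br : Letter → Letter → GL (Fin 3) (ZMod 2)) (k l : ℕ) : LGraph Gam Row :=
  if k = 0 ∧ l = 0 then graphU else runGraph br k l

theorem ncard_vlab_eq_of_cls_eq {Γ ι : Type} {g h : LGraph Γ ι} (hgh : g.cls = h.cls)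
    (s : Set ι) : {v | g.vlab v ∈ s}.ncard = {v | h.vlab v ∈ s}.ncard := by
  obtain ⟨f⟩ : Nonempty (g.Iso h) := Quotient.exact hgh
  rw [← Set.ncard_image_of_injective _ f.onV.injective]
  congr 1
  ext w
  constructor
  · rintro ⟨v, hv, rfl⟩
    simpa [f.vlab_eq] using hv
  · intro hw
    refine ⟨f.onV.symm w, ?_, f.onV.apply_symm_apply w⟩
    have := f.vlab_eq (f.onV.symm w)
    rw [f.onV.apply_symm_apply] at this
    simpa [← this] using hw

variable (br : Letter → Letter → GL (Fin 3) (ZMod 2)) (k l : ℕ)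

theorem ncard_vlab_runGraph (s : Set Row) : {v | (runGraph br k l).vlab v ∈ s}.ncard =
    {v | v ∈ runNodes k l ∧ runLabel k l v ∈ s}.ncard := by
  change Set.ncard {v : runNodes k l | runLabel k l v ∈ s} = _
  rw [← Set.ncard_image_of_injective _ Subtype.val_injective]
  congr 1
  ext v
  simp [and_comm]

/-- The index `k` is recovered from the graph as the number of its vertices over `B`, and `l` as
the number of its vertices over `C`. -/
theorem ncard_B_pairGraph :
    {v | (pairGraph br k l).vlab v ∈ ({.Bo11, .Bo10} : Set Row)}.ncard = k := by
  by_cases h : k = 0 ∧ l = 0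
  · rw [show pairGraph br k l = graphU from if_pos h, h.1]
    simp [graphU]
  · rw [show pairGraph br k l = runGraph br k l from if_neg h,
      ncard_vlab_runGraph]
    have : {v | v ∈ runNodes k l ∧ runLabel k l v ∈ ({.Bo11, .Bo10} : Set Row)} =
        Node.b '' Set.Icc 1 k := by
      ext v
      cases v <;> simp [runLabel, nodeLabel] <;> (try split_ifs) <;> try simp
      all_goals omega
    rw [this, Set.ncard_image_of_injective _ fun i j => by simp]
    simp

theorem ncard_C_pairGraph :
    {v | (pairGraph br k l).vlab v ∈ ({.Co11, .Co10} : Set Row)}.ncard = l := by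
  by_cases h : k = 0 ∧ l = 0
  · rw [show pairGraph br k l = graphU from if_pos h, h.2]
    simp [graphU]
  · rw [show pairGraph br k l = runGraph br k l from if_neg h,
      ncard_vlab_runGraph]
    have : {v | v ∈ runNodes k l ∧ runLabel k l v ∈ ({.Co11, .Co10} : Set Row)} =
        Node.c '' Set.Icc 1 l := by
      ext v
      cases v <;> simp [runLabel, nodeLabel] <;> (try split_ifs) <;> try simp
      all_goals omega
    rw [this, Set.ncard_image_of_injective _ fun i j => by simp]
    simp

variable {br k l} in
theorem eq_of_cls_pairGraph_eq {k' l' : ℕ}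
    (h : (pairGraph br k l).cls = (pairGraph br k' l').cls) : k = k' ∧ l = l' :=
  ⟨by simpa only [ncard_B_pairGraph] using ncard_vlab_eq_of_cls_eq h {.Bo11, .Bo10},
    by simpa only [ncard_C_pairGraph] using ncard_vlab_eq_of_cls_eq h {.Co11, .Co10}⟩

end

/-! ### The vertex sets of the embedded graphs, and their measures -/

section
variable {p : ℕ}

/-- The points to which the vertex `v` of the graph of runs of lengths `k` and `l` can be sent. -/
def vertexSet (p : ℕ) (nm : Letter ≃ (Fin 3 → ZMod 2)) (k l : ℕ) (v : Node) : Set (Space p) :=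
  {x | IsWindow k l (fun j => x.1 (j - v.pos k l)) ∧ x.2 = nm v.letter}

/-- The points that are vertices of an embedded graph with index `(k, l)`. -/
def pairSet (p : ℕ) (nm : Letter ≃ (Fin 3 → ZMod 2)) (k l : ℕ) : Set (Space p) :=
  if k = 0 ∧ l = 0 then rowCell p nm .U else ⋃ v ∈ runNodes k l, vertexSet p nm k l v

theorem embed_of_mem_vertexSet {nm : Letter ≃ (Fin 3 → ZMod 2)} {k l : ℕ} {v : Node}
    {x : Space p} (hx : x ∈ vertexSet p nm k l v) :
    embed nm k l (fun j => x.1 (j - v.pos k l)) v = x := by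
  refine Prod.ext (funext fun j => ?_) hx.2.symm
  simp [embed]

theorem exists_isMaximalEmbedded_of_mem_pairSet [NeZero p] {nm : Letter ≃ (Fin 3 → ZMod 2)}
    {br : Letter → Letter → GL (Fin 3) (ZMod 2)}
    (hbr : ∀ x y, x ≠ .U₁ → x ≠ .U₂ → y ≠ .U₁ → y ≠ .U₂ →
      (br x y : Matrix (Fin 3) (Fin 3) (ZMod 2)).mulVec (nm x) = nm y)
    {k l : ℕ} {x : Space p} (hx : x ∈ pairSet p nm k l) :
    ∃ φ, IsMaximalEmbedded (opS p nm br) (pairGraph br k l) φ ∧ x ∈ Set.range φ := by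
  by_cases h : k = 0 ∧ l = 0
  · rw [pairSet, if_pos h] at hx
    rw [show pairGraph br k l = graphU from if_pos h]
    exact ⟨_, isMaximalEmbedded_graphU hbr hx, (), rfl⟩
  · rw [pairSet, if_neg h] at hx
    rw [show pairGraph br k l = runGraph br k l from if_neg h]
    obtain ⟨v, hv, hxv⟩ := Set.mem_iUnion₂.1 hx
    exact ⟨_, isMaximalEmbedded_runGraph hbr (by omega) hxv.1, ⟨v, hv⟩,
      embed_of_mem_vertexSet hxv⟩

/-! ### Almost every point is a vertex of one of the graphs -/

theorem isWindow_of {k l : ℕ} {m : ℤ → ZMod p} (s : ℤ) (h0 : m (-s) = 0)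
    (hk : ∀ j, -s < j → j < k + 1 - s → m j ≠ 0) (h1 : m (k + 1 - s) = 0)
    (hl : ∀ j, k + 1 - s < j → j < k + l + 2 - s → m j ≠ 0) (h2 : m (k + l + 2 - s) = 0) :
    IsWindow k l fun j => m (j - s) := by
  intro j hj0 hj
  constructor
  · intro hm
    by_contra hne
    rcases lt_or_ge j (k + 1) with hjk | hjk
    · exact hk (j - s) (by omega) (by omega) hm
    · exact hl (j - s) (by omega) (by omega) hm
  · rintro (rfl | rfl | rfl)
    · simpa using h0
    · exact h1
    · exact h2

theorem exists_isWindow (hp : 2 ≤ p) (k l : ℕ) : ∃ m : ℤ → ZMod p, IsWindow k l m := by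
  have : Fact (1 < p) := ⟨hp⟩
  refine ⟨fun j => if j = 0 ∨ j = k + 1 ∨ j = k + l + 2 then 0 else 1, fun j _ _ => ?_⟩
  simp
  tauto

theorem exists_first_zero {m : ℤ → ZMod p} (hR : ∀ n, ∃ j, n ≤ j ∧ m j = 0) (n : ℤ) :
    ∃ e, n ≤ e ∧ m e = 0 ∧ ∀ j, n ≤ j → j < e → m j ≠ 0 := by
  obtain ⟨e, ⟨h1, h2⟩, h3⟩ := Int.exists_least_of_bdd (P := fun j => n ≤ j ∧ m j = 0)
    ⟨n, fun z hz => hz.1⟩ (hR n)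
  exact ⟨e, h1, h2, fun j hj hje h0 => absurd (h3 j ⟨hj, h0⟩) (by omega)⟩

theorem exists_last_zero {m : ℤ → ZMod p} (hL : ∀ n, ∃ j, j ≤ n ∧ m j = 0) (n : ℤ) :
    ∃ e, e ≤ n ∧ m e = 0 ∧ ∀ j, e < j → j ≤ n → m j ≠ 0 := by
  obtain ⟨e, ⟨h1, h2⟩, h3⟩ := Int.exists_greatest_of_bdd (P := fun j => j ≤ n ∧ m j = 0)
    ⟨n, fun z hz => hz.1⟩ (hL n)
  exact ⟨e, h1, h2, fun j hj hje h0 => absurd (h3 j ⟨hje, h0⟩) (by omega)⟩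

variable {nm : Letter ≃ (Fin 3 → ZMod 2)}

theorem mem_pairSet_of_mem_vertexSet {k l : ℕ} {v : Node} (hv : v ∈ runNodes k l)
    {x : Space p} (hx : x ∈ vertexSet p nm k l v) : x ∈ pairSet p nm k l := by
  have h : ¬(k = 0 ∧ l = 0) := by
    have := pos_mem_window hv
    rintro ⟨rfl, rfl⟩
    cases v <;> simp at hv <;> omega
  rw [pairSet, if_neg h]
  exact Set.mem_biUnion hv hx

theorem nonempty_pairSet (hp : 2 ≤ p) (k l : ℕ) : (pairSet p nm k l).Nonempty := by
  by_cases h : k = 0 ∧ l = 0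
  · rw [pairSet, if_pos h]
    refine ⟨(0, nm .U₁), ?_⟩
    by_contra hU
    simpa using notMem_rowCell_U.1 hU
  · obtain ⟨m, hm⟩ := exists_isWindow hp k l
    obtain ⟨v, hv⟩ : ∃ v, v ∈ runNodes k l := by
      by_cases hk : k = 0
      · exact ⟨.f, by simp; omega⟩
      · exact ⟨.a 1, by simp; omega⟩
    exact ⟨embed nm k l m v, mem_pairSet_of_mem_vertexSet hv ⟨by simpa [embed] using hm, rfl⟩⟩

/-- If the zeros of a sequence are unbounded in both directions, then every point over the
sequence is a vertex of one of the graphs. -/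
theorem exists_mem_pairSet {x : Space p} (hR : ∀ n, ∃ j, n ≤ j ∧ x.1 j = 0)
    (hL : ∀ n, ∃ j, j ≤ n ∧ x.1 j = 0) : ∃ k l, x ∈ pairSet p nm k l := by
  by_cases hU : x ∈ rowCell p nm .U
  · exact ⟨0, 0, by rwa [pairSet, if_pos ⟨rfl, rfl⟩]⟩
  -- A point over a nonzero entry of a first run (letters `A`, `B`).
  have hAB : x.1 0 ≠ 0 → ∃ k l i : ℕ, 1 ≤ i ∧ i ≤ k ∧
      IsWindow k l (fun j => x.1 (j - (k + 1 - i))) := by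
    intro h0
    obtain ⟨s, hs, hs0, hs1⟩ := exists_last_zero hL 0
    obtain ⟨e, he, he0, he1⟩ := exists_first_zero hR 0
    obtain ⟨e', he', he0', he1'⟩ := exists_first_zero hR (e + 1)
    have hsne : s ≠ 0 := fun h => h0 (h ▸ hs0)
    have hene : e ≠ 0 := fun h => h0 (h ▸ he0)
    obtain ⟨k, hk⟩ := Int.eq_ofNat_of_zero_le (show 0 ≤ e - s - 1 by omega)
    obtain ⟨l, hl⟩ := Int.eq_ofNat_of_zero_le (show 0 ≤ e' - e - 1 by omega)
    obtain ⟨i, hi⟩ := Int.eq_ofNat_of_zero_le (show 0 ≤ e by omega)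
    refine ⟨k, l, i, by omega, by omega, isWindow_of _ ?_ (fun j h1 h2 => ?_) ?_
      (fun j h1 h2 => he1' j (by omega) (by omega)) ?_⟩
    · convert hs0 using 2; omega
    · rcases le_or_gt j 0 with hj | hj
      · exact hs1 j (by omega) hj
      · exact he1 j hj.le (by omega)
    · convert he0 using 2; omega
    · convert he0' using 2; omega
  -- A point over a nonzero entry of a second run (letters `C`, `D`, `F`).
  have hCD : x.1 0 ≠ 0 → ∃ k l i : ℕ, 1 ≤ i ∧ i ≤ l ∧
      IsWindow k l (fun j => x.1 (j - (k + 1 + i))) := by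
    intro h0
    obtain ⟨s, hs, hs0, hs1⟩ := exists_last_zero hL 0
    obtain ⟨e, he, he0, he1⟩ := exists_first_zero hR 0
    obtain ⟨s', hs', hs0', hs1'⟩ := exists_last_zero hL (s - 1)
    have hsne : s ≠ 0 := fun h => h0 (h ▸ hs0)
    have hene : e ≠ 0 := fun h => h0 (h ▸ he0)
    obtain ⟨k, hk⟩ := Int.eq_ofNat_of_zero_le (show 0 ≤ s - s' - 1 by omega)
    obtain ⟨l, hl⟩ := Int.eq_ofNat_of_zero_le (show 0 ≤ e - s - 1 by omega)
    obtain ⟨i, hi⟩ := Int.eq_ofNat_of_zero_le (show 0 ≤ -s by omega)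
    refine ⟨k, l, i, by omega, by omega, isWindow_of _ ?_
      (fun j h1 h2 => hs1' j (by omega) (by omega)) ?_ (fun j h1 h2 => ?_) ?_⟩
    · convert hs0' using 2; omega
    · convert hs0 using 2; omega
    · rcases le_or_gt j 0 with hj | hj
      · exact hs1 j (by omega) hj
      · exact he1 j hj.le (by omega)
    · convert he0 using 2; omega
  rcases notMem_rowCell_U.1 hU with
    ⟨h0, hA⟩ | ⟨h0, hB⟩ | ⟨h0, hC⟩ | ⟨h0, hD⟩ | ⟨h0, h1, hF⟩ | ⟨h', h0, h1, hI⟩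
  · obtain ⟨k, l, i, hi1, hi2, hw⟩ := hAB h0
    exact ⟨k, l, mem_pairSet_of_mem_vertexSet (v := .a i) ⟨hi1, hi2⟩ ⟨hw, hA⟩⟩
  · obtain ⟨k, l, i, hi1, hi2, hw⟩ := hAB h0
    exact ⟨k, l, mem_pairSet_of_mem_vertexSet (v := .b i) ⟨hi1, hi2⟩ ⟨hw, hB⟩⟩
  · obtain ⟨k, l, i, hi1, hi2, hw⟩ := hCD h0
    exact ⟨k, l, mem_pairSet_of_mem_vertexSet (v := .c i) ⟨hi1, hi2⟩ ⟨hw, hC⟩⟩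
  · obtain ⟨k, l, i, hi1, hi2, hw⟩ := hCD h0
    exact ⟨k, l, mem_pairSet_of_mem_vertexSet (v := .d i) ⟨hi1, hi2⟩ ⟨hw, hD⟩⟩
  · obtain ⟨k, l, i, hi1, hi2, hw⟩ := hCD h0
    -- The run ends at the position of the point.
    obtain rfl : i = l := by
      have := (hw (k + 1 + i + 1) (by omega) (by omega)).1 (by simpa using h1)
      omega
    exact ⟨k, i, mem_pairSet_of_mem_vertexSet (v := .f) hi1 ⟨hw, hF⟩⟩
  · obtain ⟨s, hs, hs0, hs1⟩ := exists_last_zero hL (-1)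
    obtain ⟨e, he, he0, he1⟩ := exists_first_zero hR 1
    have hsne : s ≠ -1 := fun h => h' (h ▸ hs0)
    have hene : e ≠ 1 := fun h => h1 (h ▸ he0)
    obtain ⟨k, hk⟩ := Int.eq_ofNat_of_zero_le (show 0 ≤ -1 - s by omega)
    obtain ⟨l, hl⟩ := Int.eq_ofNat_of_zero_le (show 0 ≤ e - 1 by omega)
    refine ⟨k, l, mem_pairSet_of_mem_vertexSet (v := .iota) ⟨by omega, by omega⟩
      ⟨isWindow_of _ ?_ (fun j h1 h2 => hs1 j ?_ ?_) ?_ (fun j h1 h2 => he1 j ?_ ?_) ?_, hI⟩⟩ <;>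
      simp only [Node.pos] at *
    · convert hs0 using 2; omega
    · omega
    · omega
    · convert h0 using 2; omega
    · omega
    · omega
    · convert he0 using 2; omega

theorem ae_exists_mem_pairSet [NeZero p] (nm : Letter ≃ (Fin 3 → ZMod 2)) :
    ∀ᵐ x ∂haar p, ∃ k l, x ∈ pairSet p nm k l := by
  have hR : ∀ᵐ x ∂haar p, ∀ n : ℤ, ∃ i : ℕ, x.1 (n + i) = 0 :=
    ae_all_iff.2 fun n => ae_exists_eq_zero p (fun i => n + i) fun i j h => by simpa using h
  have hL : ∀ᵐ x ∂haar p, ∀ n : ℤ, ∃ i : ℕ, x.1 (n - i) = 0 :=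
    ae_all_iff.2 fun n => ae_exists_eq_zero p (fun i => n - i) fun i j h => by simpa using h
  filter_upwards [hR, hL] with x hR hL
  refine exists_mem_pairSet (fun n => ?_) (fun n => ?_)
  · obtain ⟨i, hi⟩ := hR n
    exact ⟨n + i, by omega, hi⟩
  · obtain ⟨i, hi⟩ := hL n
    exact ⟨n - i, by omega, hi⟩

/-! ### Measures of the vertex sets -/

theorem vertexSet_eq_cylinder (k l : ℕ) (v : Node) : vertexSet p nm k l v =
    cylinder p {-v.pos k l, k + 1 - v.pos k l, k + l + 2 - v.pos k l}
      (Finset.Icc (-v.pos k l) (k + l + 2 - v.pos k l) \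
        {-v.pos k l, k + 1 - v.pos k l, k + l + 2 - v.pos k l}) (nm v.letter) := by
  ext x
  set s := v.pos k l
  simp only [vertexSet, cylinder, Set.mem_ofPred_eq, ← and_assoc]
  refine and_congr_left fun _ => ⟨fun h => ⟨fun j hj => ?_, fun j hj h0 => ?_⟩, fun h => ?_⟩
  · simp only [Finset.mem_insert, Finset.mem_singleton] at hj
    have := (h (j + s) (by omega) (by omega)).2 (by omega)
    simpa [s] using this
  · simp only [Finset.mem_sdiff, Finset.mem_Icc, Finset.mem_insert, Finset.mem_singleton] at hj
    have := (h (j + s) (by omega) (by omega)).1 (by simpa [s] using h0)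
    omega
  · refine isWindow_of s (h.1 _ (by simp)) (fun j h1 h2 => h.2 j ?_) (h.1 _ (by simp))
      (fun j h1 h2 => h.2 j ?_) (h.1 _ (by simp)) <;>
    · simp only [Finset.mem_sdiff, Finset.mem_Icc, Finset.mem_insert, Finset.mem_singleton]
      omega

theorem measurableSet_vertexSet [NeZero p] (k l : ℕ) (v : Node) :
    MeasurableSet (vertexSet p nm k l v) := by
  rw [vertexSet_eq_cylinder]
  exact measurableSet_cylinder p _ _ _

theorem haar_vertexSet [NeZero p] (k l : ℕ) (v : Node) : haar p (vertexSet p nm k l v) =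
    ENNReal.ofReal (1 / 8 * (1 / (p : ℝ)) ^ 3 * (((p : ℝ) - 1) / p) ^ (k + l)) := by
  rw [vertexSet_eq_cylinder, haar_cylinder p _ _ Finset.disjoint_sdiff]
  set s := v.pos k l
  have h3 : ({-s, k + 1 - s, k + l + 2 - s} : Finset ℤ).card = 3 := by
    rw [Finset.card_eq_three]
    exact ⟨_, _, _, by omega, by omega, by omega, rfl⟩
  rw [Finset.card_sdiff_of_subset, h3, Int.card_Icc]
  · congr 3
    omega
  · intro j
    simp only [Finset.mem_Icc, Finset.mem_insert, Finset.mem_singleton]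
    omega

theorem ncard_runNodes (k l : ℕ) : (runNodes k l).Finite ∧ (runNodes k l).ncard =
    2 * k + (if 1 ≤ l then 2 * l + 1 else 0) + (if 1 ≤ k ∧ 1 ≤ l then 1 else 0) := by
  classical
  let s : Finset Node := (Finset.Icc 1 k).image .a ∪ (Finset.Icc 1 k).image .b ∪
    (Finset.Icc 1 l).image .c ∪ (Finset.Icc 1 l).image .d ∪
    (if 1 ≤ l then {.f} else ∅) ∪ (if 1 ≤ k ∧ 1 ≤ l then {.iota} else ∅)
  have hs : runNodes k l = s := by
    ext v
    cases v <;> simp [s] <;> split_ifs <;> simp <;> omega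
  rw [hs, Set.ncard_coe_finset]
  refine ⟨s.finite_toSet, ?_⟩
  simp only [s]
  rw [Finset.card_union_of_disjoint, Finset.card_union_of_disjoint, Finset.card_union_of_disjoint,
    Finset.card_union_of_disjoint, Finset.card_union_of_disjoint,
    Finset.card_image_of_injective _ fun i j => by simp,
    Finset.card_image_of_injective _ fun i j => by simp,
    Finset.card_image_of_injective _ fun i j => by simp,
    Finset.card_image_of_injective _ fun i j => by simp]
  · split_ifs <;> simp <;> omega
  all_goals
    rw [Finset.disjoint_left]
    intro v
    cases v <;> simp <;> split_ifs <;> simp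

theorem measurableSet_pairSet [NeZero p] (k l : ℕ) : MeasurableSet (pairSet p nm k l) := by
  unfold pairSet
  split_ifs
  · exact (opS p nm fun _ _ => 1).measurable_cell .U
  · exact (ncard_runNodes k l).1.measurableSet_biUnion fun v _ => measurableSet_vertexSet k l v

theorem haar_pairSet [NeZero p] {k l : ℕ} (hkl : ¬(k = 0 ∧ l = 0)) :
    haar p (pairSet p nm k l) = ENNReal.ofReal ((runNodes k l).ncard *
      (1 / 8 * (1 / (p : ℝ)) ^ 3 * (((p : ℝ) - 1) / p) ^ (k + l))) := by
  have hfin := (ncard_runNodes k l).1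
  rw [pairSet, if_neg hkl, measure_biUnion hfin.countable]
  · simp only [haar_vertexSet]
    rw [ENNReal.tsum_const, ENNReal.ofReal_mul (Nat.cast_nonneg _), ENNReal.ofReal_natCast]
    congr 1
    rw [Set.ncard_def, ← Set.encard, ← hfin.cast_ncard_eq]
    simp [Set.ncard_def]
  · intro v hv w hw hvw
    refine Set.disjoint_left.2 fun x hxv hxw =>
      hvw (embed_injective (nm := nm) hxv.1 hxw.1 hv hw ?_)
    rw [embed_of_mem_vertexSet hxv, embed_of_mem_vertexSet hxw]
  · exact fun v _ => measurableSet_vertexSet k l v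

theorem haar_rowCell_U [NeZero p] : haar p (rowCell p nm .U) =
    ENNReal.ofReal (1 / 8 * (2 + 5 * (1 / (p : ℝ)) + (1 / (p : ℝ)) ^ 3 +
      2 * (((p : ℝ) - 1) / p) * (1 / (p : ℝ)) ^ 2 + ((p : ℝ) - 1) / p +
      (((p : ℝ) - 1) / p) ^ 2)) := by
  have hp : (p : ℝ) ≠ 0 := Nat.cast_ne_zero.2 (NeZero.ne p)
  have hp1 : (1 : ℝ) ≤ p := Nat.one_le_cast.2 (NeZero.one_le)
  have hq : 0 ≤ ((p : ℝ) - 1) / p := div_nonneg (by linarith) (by linarith)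
  have hc : (rowCell p nm .U)ᶜ = cylinder p ∅ {0} (nm .A) ∪ (cylinder p ∅ {0} (nm .B) ∪
      (cylinder p ∅ {0} (nm .C) ∪ (cylinder p ∅ {0} (nm .D) ∪
        (cylinder p {1} {0} (nm .F) ∪ cylinder p {0} {-1, 1} (nm .I))))) := by
    ext x
    rw [Set.mem_compl_iff, notMem_rowCell_U]
    simp [cylinder]
    tauto
  have hd : ∀ {T N T' N' : Finset ℤ} {L L' : Letter}, L ≠ L' →
      Disjoint (cylinder p T N (nm L)) (cylinder p T' N' (nm L')) := fun hL =>
    Set.disjoint_left.2 fun x hx hx' => hL (nm.injective (hx.2.2.symm.trans hx'.2.2))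
  have hm := measurableSet_cylinder p
  have hU : MeasurableSet (rowCell p nm .U) := (opS p nm fun _ _ => 1).measurable_cell .U
  have h := prob_compl_eq_one_sub (μ := haar p) hU.compl
  rw [compl_compl, hc] at h
  rw [h, measure_union, measure_union, measure_union, measure_union, measure_union]
  · rw [haar_cylinder, haar_cylinder, haar_cylinder, haar_cylinder, haar_cylinder, haar_cylinder]
    · simp only [Finset.card_empty, Finset.card_singleton,
        Finset.card_pair (show (-1 : ℤ) ≠ 1 by decide)]
      rw [← ENNReal.ofReal_add, ← ENNReal.ofReal_add, ← ENNReal.ofReal_add, ← ENNReal.ofReal_add,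
        ← ENNReal.ofReal_add, ← ENNReal.ofReal_one, ← ENNReal.ofReal_sub]
      · congr 1
        field_simp
        ring
      all_goals positivity
    all_goals simp
  all_goals
    first
      | exact hd (by simp)
      | (simp only [Set.disjoint_union_right]; and_intros <;> exact hd (by simp))
      | (repeat' first | exact hm _ _ _ | apply MeasurableSet.union)

end

/-! ### The measure on the set of graphs -/

section
variable {p : ℕ} [NeZero p] {nm : Letter ≃ (Fin 3 → ZMod 2)}
  {br : Letter → Letter → GL (Fin 3) (ZMod 2)}

theorem SGraphsFin.measure_singleton {Γ X ι : Type} [Group Γ] [MeasurableSpace X]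
    (S : Operator Γ X ι) (μ : Measure X) (c : SGraphsFin S) :
    SGraphsFin.measure S μ {c} = SGraphsFin.weight S μ c := by
  rw [SGraphsFin.measure, Measure.sum_apply _ (MeasurableSpace.measurableSet_top),
    tsum_eq_single c]
  · simp
  · intro c' hc'
    simp [hc']

theorem SGraphsFin.measure_univ {Γ X ι : Type} [Group Γ] [MeasurableSpace X]
    (S : Operator Γ X ι) (μ : Measure X) :
    SGraphsFin.measure S μ Set.univ = ∑' c, SGraphsFin.weight S μ c := by
  rw [SGraphsFin.measure, Measure.sum_apply _ MeasurableSet.univ]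
  simp

/-- The element of the set of graphs with index `(k, l)`. -/
def pairPoint (hp : 2 ≤ p)
    (hbr : ∀ x y, x ≠ .U₁ → x ≠ .U₂ → y ≠ .U₁ → y ≠ .U₂ →
      (br x y : Matrix (Fin 3) (Fin 3) (ZMod 2)).mulVec (nm x) = nm y)
    (kl : ℕ × ℕ) : Graphs p nm br :=
  ⟨(pairGraph br kl.1 kl.2).cls, pairGraph br kl.1 kl.2, rfl, by
    unfold pairGraph
    split_ifs
    · exact inferInstanceAs (Finite Unit)
    · exact (ncard_runNodes kl.1 kl.2).1.to_subtype, by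
    obtain ⟨x, hx⟩ := nonempty_pairSet (nm := nm) hp kl.1 kl.2
    obtain ⟨φ, hφ, -⟩ := exists_isMaximalEmbedded_of_mem_pairSet hbr hx
    exact ⟨φ, hφ⟩⟩

variable (hp : 2 ≤ p)
  (hbr : ∀ x y, x ≠ .U₁ → x ≠ .U₂ → y ≠ .U₁ → y ≠ .U₂ →
    (br x y : Matrix (Fin 3) (Fin 3) (ZMod 2)).mulVec (nm x) = nm y)

theorem pairPoint_injective : Function.Injective (pairPoint hp hbr) := fun _ _ h =>
  have := eq_of_cls_pairGraph_eq (congrArg Subtype.val h)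
  Prod.ext this.1 this.2

/-- A point of `pairSet p nm k l` lies on a graph of the class `c` only if `c` is the class with
index `(k, l)`. -/
theorem eq_pairPoint_of_mem {kl : ℕ × ℕ} {x : Space p} (hx : x ∈ pairSet p nm kl.1 kl.2)
    {c : Graphs p nm br}
    (hc : ∃ g : LGraph Gam Row, g.cls = c.1 ∧
      ∃ φ, IsMaximalEmbedded (opS p nm br) g φ ∧ x ∈ Set.range φ) : c = pairPoint hp hbr kl := by
  obtain ⟨g, hg, φ, hφ, hxφ⟩ := hc
  obtain ⟨ψ, hψ, hxψ⟩ := exists_isMaximalEmbedded_of_mem_pairSet hbr hx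
  exact Subtype.ext (hg ▸ hφ.cls_eq hψ hxφ hxψ)

/-- Embedded graphs of the class with index `(k, l)` may have vertices outside `pairSet p nm k l`,
but only in the null set of the points in none of these sets. -/
theorem weight_pairPoint (kl : ℕ × ℕ) :
    SGraphsFin.weight (opS p nm br) (haar p) (pairPoint hp hbr kl) =
      haar p (pairSet p nm kl.1 kl.2) := by
  refine measure_congr ?_
  filter_upwards [ae_exists_mem_pairSet nm] with x ⟨k, l, hx⟩
  refine propext ⟨fun h => ?_, fun h => ?_⟩
  · have : kl = (k, l) := pairPoint_injective hp hbr
      (eq_pairPoint_of_mem hp hbr (kl := (k, l)) hx h)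
    rw [this]
    exact hx
  · exact ⟨_, rfl, exists_isMaximalEmbedded_of_mem_pairSet hbr h⟩

theorem weight_eq_zero {c : Graphs p nm br} (hc : c ∉ Set.range (pairPoint hp hbr)) :
    SGraphsFin.weight (opS p nm br) (haar p) c = 0 := by
  refine measure_mono_null (fun x hx => ?_) (ae_iff.1 (ae_exists_mem_pairSet nm))
  rintro ⟨k, l, hkl⟩
  exact hc ⟨(k, l), (eq_pairPoint_of_mem hp hbr (kl := (k, l)) hkl hx).symm⟩

theorem isProbabilityMeasure_graphsMeasure (hp : 2 ≤ p)
    (hbr : ∀ x y, x ≠ .U₁ → x ≠ .U₂ → y ≠ .U₁ → y ≠ .U₂ →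
      (br x y : Matrix (Fin 3) (Fin 3) (ZMod 2)).mulVec (nm x) = nm y) :
    IsProbabilityMeasure (graphsMeasure p nm br) := by
  refine ⟨?_⟩
  rw [graphsMeasure, SGraphsFin.measure_univ,
    ← (pairPoint_injective hp hbr).tsum_eq fun c hc => by
      by_contra h
      exact hc (weight_eq_zero hp hbr h)]
  simp only [weight_pairPoint]
  rw [← measure_iUnion, ← measure_univ (μ := haar p)]
  · refine measure_congr ?_
    filter_upwards [ae_exists_mem_pairSet nm] with x ⟨k, l, hx⟩
    exact propext ⟨fun _ => trivial, fun _ => Set.mem_iUnion.2 ⟨(k, l), hx⟩⟩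
  · intro kl kl' hne
    refine Set.disjoint_left.2 fun x hx hx' => hne (pairPoint_injective hp hbr ?_)
    exact eq_pairPoint_of_mem hp hbr hx'
      ⟨_, rfl, exists_isMaximalEmbedded_of_mem_pairSet hbr hx⟩
  · exact fun kl => measurableSet_pairSet _ _

end

end Lamplighter

theorem mainTheorem4 (p : ℕ) [NeZero p] (hp : 2 ≤ p)
    (nm : Lamplighter.Letter ≃ (Fin 3 → ZMod 2))
    (hnm : ∀ x, x ≠ .U₁ → x ≠ .U₂ → nm x ≠ 0)
    (br : Lamplighter.Letter → Lamplighter.Letter → GL (Fin 3) (ZMod 2))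
    (hbr : ∀ x y, x ≠ .U₁ → x ≠ .U₂ → y ≠ .U₁ → y ≠ .U₂ →
      (br x y : Matrix (Fin 3) (Fin 3) (ZMod 2)).mulVec (nm x) = nm y) :
    ∃ (u : Lamplighter.Graphs p nm br) (g h : ℕ → Lamplighter.Graphs p nm br)
      (j : ℕ → ℕ → Lamplighter.Graphs p nm br),
      u.1 = Lamplighter.graphU.cls ∧
      (∀ k, 1 ≤ k → (g k).1 = (Lamplighter.graphG br k).cls) ∧
      (∀ l, 1 ≤ l → (h l).1 = (Lamplighter.graphH br l).cls) ∧
      (∀ k l, 1 ≤ k → 1 ≤ l → (j k l).1 = (Lamplighter.graphJ br k l).cls) ∧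
      MeasureTheory.IsProbabilityMeasure (Lamplighter.graphsMeasure p nm br) ∧
      (∀ c, Lamplighter.graphsMeasure p nm br {c} ≠ 0 ↔
        c = u ∨ (∃ k, 1 ≤ k ∧ c = g k) ∨ (∃ l, 1 ≤ l ∧ c = h l) ∨
          ∃ k l, 1 ≤ k ∧ 1 ≤ l ∧ c = j k l) ∧
      Lamplighter.graphsMeasure p nm br {u} =
        ENNReal.ofReal (1 / 8 * (2 + 5 * (1 / (p : ℝ)) + (1 / (p : ℝ)) ^ 3 +
          2 * (((p : ℝ) - 1) / p) * (1 / (p : ℝ)) ^ 2 + ((p : ℝ) - 1) / p +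
          (((p : ℝ) - 1) / p) ^ 2)) ∧
      (∀ k : ℕ, 1 ≤ k → Lamplighter.graphsMeasure p nm br {g k} =
        ENNReal.ofReal (2 * (k : ℝ) * (1 / 8) * (1 / (p : ℝ)) ^ 3 * (((p : ℝ) - 1) / p) ^ k)) ∧
      (∀ l : ℕ, 1 ≤ l → Lamplighter.graphsMeasure p nm br {h l} =
        ENNReal.ofReal ((2 * (l : ℝ) + 1) * (1 / 8) * (1 / (p : ℝ)) ^ 3 *
          (((p : ℝ) - 1) / p) ^ l)) ∧
      (∀ k l : ℕ, 1 ≤ k → 1 ≤ l → Lamplighter.graphsMeasure p nm br {j k l} =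
        ENNReal.ofReal ((2 * (k : ℝ) + 2 * (l : ℝ) + 2) * (1 / 8) * (1 / (p : ℝ)) ^ 3 *
          (((p : ℝ) - 1) / p) ^ (k + l))) := by
  have hp0 : (0 : ℝ) < p := Nat.cast_pos.2 (by omega)
  have hp1 : (0 : ℝ) < (p : ℝ) - 1 := sub_pos.2 (Nat.one_lt_cast.2 hp)
  have hval : ∀ kl, Lamplighter.graphsMeasure p nm br {Lamplighter.pairPoint hp hbr kl} =
      Lamplighter.haar p (Lamplighter.pairSet p nm kl.1 kl.2) := fun kl => by
    rw [Lamplighter.graphsMeasure, Lamplighter.SGraphsFin.measure_singleton,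
      Lamplighter.weight_pairPoint]
  have hu : Lamplighter.graphsMeasure p nm br {Lamplighter.pairPoint hp hbr (0, 0)} = _ :=
    (hval _).trans ((congrArg _ (if_pos ⟨rfl, rfl⟩)).trans Lamplighter.haar_rowCell_U)
  have hg : ∀ k : ℕ, 1 ≤ k →
      Lamplighter.graphsMeasure p nm br {Lamplighter.pairPoint hp hbr (k, 0)} =
        ENNReal.ofReal (2 * (k : ℝ) * (1 / 8) * (1 / (p : ℝ)) ^ 3 *
          (((p : ℝ) - 1) / p) ^ k) := fun k hk => by
    rw [hval, Lamplighter.haar_pairSet (by simp; omega), (Lamplighter.ncard_runNodes _ _).2]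
    congr 1
    simp
    ring
  have hh : ∀ l : ℕ, 1 ≤ l →
      Lamplighter.graphsMeasure p nm br {Lamplighter.pairPoint hp hbr (0, l)} =
        ENNReal.ofReal ((2 * (l : ℝ) + 1) * (1 / 8) * (1 / (p : ℝ)) ^ 3 *
          (((p : ℝ) - 1) / p) ^ l) := fun l hl => by
    rw [hval, Lamplighter.haar_pairSet (by simp; omega), (Lamplighter.ncard_runNodes _ _).2]
    congr 1
    simp [hl]
    ring
  have hj : ∀ k l : ℕ, 1 ≤ k → 1 ≤ l →
      Lamplighter.graphsMeasure p nm br {Lamplighter.pairPoint hp hbr (k, l)} =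
        ENNReal.ofReal ((2 * (k : ℝ) + 2 * (l : ℝ) + 2) * (1 / 8) * (1 / (p : ℝ)) ^ 3 *
          (((p : ℝ) - 1) / p) ^ (k + l)) := fun k l hk hl => by
    rw [hval, Lamplighter.haar_pairSet (by simp; omega), (Lamplighter.ncard_runNodes _ _).2]
    congr 1
    simp [hk, hl]
    ring
  refine ⟨Lamplighter.pairPoint hp hbr (0, 0), fun k => Lamplighter.pairPoint hp hbr (k, 0),
    fun l => Lamplighter.pairPoint hp hbr (0, l),
    fun k l => Lamplighter.pairPoint hp hbr (k, l), ?_, fun k hk => ?_, fun l hl => ?_,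
    fun k l hk hl => ?_, Lamplighter.isProbabilityMeasure_graphsMeasure hp hbr, fun c => ?_,
    hu, hg, hh, hj⟩
  · exact congrArg Lamplighter.LGraph.cls (if_pos ⟨rfl, rfl⟩)
  · rw [Lamplighter.graphG_eq_runGraph br hk]
    exact congrArg Lamplighter.LGraph.cls (if_neg (by simp; omega))
  · rw [Lamplighter.graphH_eq_runGraph br hl]
    exact congrArg Lamplighter.LGraph.cls (if_neg (by simp; omega))
  · rw [Lamplighter.graphJ_eq_runGraph br hk hl]
    exact congrArg Lamplighter.LGraph.cls (if_neg (by simp; omega))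
  · constructor
    · intro hc
      have hc : c ∈ Set.range (Lamplighter.pairPoint hp hbr) := by
        by_contra h
        rw [Lamplighter.graphsMeasure, Lamplighter.SGraphsFin.measure_singleton] at hc
        exact hc (Lamplighter.weight_eq_zero hp hbr h)
      obtain ⟨⟨k, l⟩, rfl⟩ := hc
      rcases Nat.eq_zero_or_pos k with rfl | hk <;> rcases Nat.eq_zero_or_pos l with rfl | hl
      · exact Or.inl rfl
      · exact Or.inr (Or.inr (Or.inl ⟨l, hl, rfl⟩))
      · exact Or.inr (Or.inl ⟨k, hk, rfl⟩)
      · exact Or.inr (Or.inr (Or.inr ⟨k, l, hk, hl, rfl⟩))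
    · rintro (rfl | ⟨k, hk, rfl⟩ | ⟨l, hl, rfl⟩ | ⟨k, l, hk, hl, rfl⟩)
      · rw [hu]
        exact (ENNReal.ofReal_pos.2 (by positivity)).ne'
      · rw [hg k hk]
        have : (0 : ℝ) < k := Nat.cast_pos.2 hk
        exact (ENNReal.ofReal_pos.2 (by positivity)).ne'
      · rw [hh l hl]
        exact (ENNReal.ofReal_pos.2 (by positivity)).ne'
      · rw [hj k l hk hl]
        exact (ENNReal.ofReal_pos.2 (by positivity)).ne'
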